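/- Let $d\ge 1$, let $M=\{\xi\in\mathbb R^d:|\xi|=1\}$ with surface measure $\sigma$, let $(\mathcal E g)(x)=\int_M e^{2\pi i x\cdot\xi}g(\xi)\,d\sigma(\xi)$ be the Fourier extension operator on $L^2(M,d\sigma)$, and let $(\mathcal E^*F)(\xi)=\int_{\mathbb R^d}e^{-2\pi i x\cdot\xi}F(x)\,dx$, $\xi\in M$, be its adjoint. For $h>0$ and $V:\mathbb R^d\to\mathbb C$ put $V_\omega(x)=\sum_{j\in h\mathbb Z^d}\omega_jV(x)\mathbf 1_{[0,1)^d}((x-j)/h)$, where the $\omega_j$ are independent and each is a standard Gaussian or a symmetric Bernoulli ($\pm1$) random variable, so that $\mathbf E\,\omega_i\omega_j=\delta_{ij}$. Write $\|\mathcal E^*V_\omega\mathcal E\|$ for the operator norm on $L^2(M,d\sigma)$, and $\langle x\rangle=2+|x|$. For $1\le q\le\infty$ (with $1/q=0$ if $q=\infty$) and $R>1$ let $$T_R=\{(x_1,x')\in\mathbb R\times\mathbb R^{d-1}:|x_1|<R,\ |x'|<R^{1/2}\},\qquad V_R=R^{-\frac{d+1}{2q}}\mathbf 1_{T_R}.$$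 There are constants $h_0,c>0$, depending only on $d$, such that for all such families $(\omega_j)$ and all $q\in[1,\infty]$ the following hold. (i) For all $0<h<h_0$ and $R>1$, the randomization $V_{R,\omega}$ of $V_R$ at scale $h$ satisfies $$\mathbf E\|\mathcal E^*V_{R,\omega}\mathcal E\|^2\ \ge\ c\,h^d\,R^{1-\frac{d+1}{q}}\,\|V_R\|_{L^q(\mathbb R^d)}.$$ (ii) If there is a constant $C$ such that $$\mathbf E\|\mathcal E^*V_\omega\mathcal E\|\le C\,\langle h\rangle^{d/2}(\log\langle R\rangle)^{1/2}(\log\langle h\rangle+\log\langle R\rangle)^2\,\|V\|_{L^q(\mathbb R^d)}$$ for all $h,R>0$ and all $V\in L^q(\mathbb R^d)$ supported in a ball of radius $R$, then $q\le d+1$. (iii) The exponent $d+1$ cannot be increased even if arbitrary logarithmic losses are allowed: if for some $0<h<h_0$ and some $C,N\in\mathbb R$ $$\mathbf E\|\mathcal E^*V_\omega\mathcal E\|\le C(\log\langle R\rangle)^{N}\|V\|_{L^q(\mathbb R^d)}$$ for all $R>1$ and all $V\in L^q(\mathbb R^d)$ supported in a ball of radius $R$, then $q\le d+1$. -/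

import Mathlib

open MeasureTheory ProbabilityTheory
open scoped ENNReal FourierTransform

noncomputable section

namespace KnappExample

/-- Euclidean space `ℝ^d`. -/
abbrev Space (d : ℕ) : Type := EuclideanSpace ℝ (Fin d)

/-- The unit sphere `M` of `ℝ^d`. -/
abbrev USphere (d : ℕ) : Type := Metric.sphere (0 : Space d) 1

/-- Surface measure `σ` on the unit sphere `M` (for `d = 1` it is counting measure on two points). -/
def surfaceMeasure (d : ℕ) : Measure (USphere d) := (volume : Measure (Space d)).toSphere

/-- The Fourier extension operator `(ℰ g)(x) = (g dσ)^∨(x) = ∫_M e^{2πi x·ξ} g(ξ) dσ(ξ)`. -/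
def extension {d : ℕ} (g : USphere d → ℂ) (x : Space d) : ℂ :=
  ∫ ξ : USphere d,
    Complex.exp (2 * Real.pi * Complex.I * (inner ℝ x (ξ : Space d) : ℝ)) * g ξ ∂(surfaceMeasure d)

/-- The adjoint `ℰ^*` of the extension operator: restriction of the Fourier transform
`F̂(ξ) = ∫ e^{-2πi x·ξ} F(x) dx` to the unit sphere. -/
def restriction {d : ℕ} (F : Space d → ℂ) (ξ : USphere d) : ℂ := 𝓕 F (ξ : Space d)

/-- The operator norm `‖ℰ^* V ℰ‖` on `L²(M, dσ)`, as an extended nonnegative number. -/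
def sandwichNorm {d : ℕ} (V : Space d → ℂ) : ℝ≥0∞ :=
  ⨆ (g : Lp ℂ 2 (surfaceMeasure d)) (_ : ‖g‖ ≤ 1),
    eLpNorm (restriction (fun x => V x * extension (fun ξ => g ξ) x)) 2 (surfaceMeasure d)

/-- The half-open cube `j + hQ`, `Q = [0,1)^d`, at the lattice point `j = h k`, `k ∈ ℤ^d`. -/
def latticeCube {d : ℕ} (h : ℝ) (k : Fin d → ℤ) : Set (Space d) :=
  {x | ∀ i, (x i - h * (k i : ℝ)) / h ∈ Set.Ico (0 : ℝ) 1}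

/-- The randomization at scale `h`: `V_ω(x) = ∑_{j ∈ hℤ^d} ω_j V(x) 1_Q((x - j)/h)`.
The lattice `hℤ^d` is indexed by `ℤ^d`. At every point exactly one summand can be nonzero. -/
def randomize {d : ℕ} (h : ℝ) (ω : (Fin d → ℤ) → ℝ) (V : Space d → ℂ) (x : Space d) : ℂ :=
  ∑' k : Fin d → ℤ, (ω k : ℂ) * (latticeCube h k).indicator V x

/-- The symmetric Bernoulli law: the values `1` and `-1` with probability `1/2` each. -/
def symmetricBernoulli : Measure ℝ :=
  (2⁻¹ : ℝ≥0∞) • Measure.dirac (1 : ℝ) + (2⁻¹ : ℝ≥0∞) • Measure.dirac (-1 : ℝ)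

/-- Independent random variables, each of them standard Gaussian or symmetric Bernoulli
(so that `𝔼 ω_i ω_j = δ_{ij}`). -/
structure IsRandomCoefficients {d : ℕ} {Ω : Type*} [MeasurableSpace Ω] (P : Measure Ω)
    (ω : (Fin d → ℤ) → Ω → ℝ) : Prop where
  indep : iIndepFun ω P
  law : ∀ k, HasLaw (ω k) (gaussianReal 0 1) P ∨ HasLaw (ω k) symmetricBernoulli P

/-- The moment `𝔼 ‖ℰ^* V_ω ℰ‖^m` of the randomized potential. -/
def expectedNormPow {d : ℕ} {Ω : Type*} [MeasurableSpace Ω] (P : Measure Ω)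
    (ω : (Fin d → ℤ) → Ω → ℝ) (h : ℝ) (V : Space d → ℂ) (m : ℕ) : ℝ≥0∞ :=
  ∫⁻ w, sandwichNorm (randomize h (fun k => ω k w) V) ^ m ∂P

/-- The tube `T_R = {(x_1, x') : |x_1| < R, |x'| < R^{1/2}}`. -/
def tube (d : ℕ) [NeZero d] (R : ℝ) : Set (Space d) :=
  {x | |x 0| < R ∧ Real.sqrt (∑ i ∈ Finset.univ.erase 0, x i ^ 2) < Real.sqrt R}

/-- The potential `R^{-(d+1)/(2q)} 1_{T_R}`, with `1/q = 0` for `q = ∞`. -/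
def tubePotential (d : ℕ) [NeZero d] (q : ℝ≥0∞) (R : ℝ) : Space d → ℂ :=
  (tube d R).indicator fun _ => ((R ^ (-(((d : ℝ) + 1) / 2 * (q⁻¹).toReal)) : ℝ) : ℂ)

/-- `⟨x⟩ = 2 + |x|`. -/
def bracket (x : ℝ) : ℝ := 2 + |x|

/-- The local extension bound with the Lebesgue exponent `q`: there is a constant `C` with
`𝔼 ‖ℰ^* V_ω ℰ‖ ≤ C ⟨h⟩^{d/2} (log⟨R⟩)^{1/2} (log⟨h⟩ + log⟨R⟩)^2 ‖V‖_q`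
for all `h, R > 0` and all `V ∈ L^q` that are supported in a ball of radius `R`. -/
def LocalExtensionBound {d : ℕ} {Ω : Type*} [MeasurableSpace Ω] (P : Measure Ω)
    (ω : (Fin d → ℤ) → Ω → ℝ) (q : ℝ≥0∞) : Prop :=
  ∃ C : ℝ, ∀ h R : ℝ, 0 < h → 0 < R → ∀ (x₀ : Space d) (V : Space d → ℂ),
    MemLp V q volume → Function.support V ⊆ Metric.closedBall x₀ R →
    expectedNormPow P ω h V 1 ≤
      ENNReal.ofReal (C * bracket h ^ ((d : ℝ) / 2) * Real.log (bracket R) ^ (1 / 2 : ℝ) *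
        (Real.log (bracket h) + Real.log (bracket R)) ^ 2) * eLpNorm V q volume

/-- The same bound at a single scale `h`, for `R > 1` only, with an arbitrary constant and an
arbitrary power `N` of the logarithm. -/
def LogExtensionBound {d : ℕ} {Ω : Type*} [MeasurableSpace Ω] (P : Measure Ω)
    (ω : (Fin d → ℤ) → Ω → ℝ) (q : ℝ≥0∞) (h C N : ℝ) : Prop :=
  ∀ R : ℝ, 1 < R → ∀ (x₀ : Space d) (V : Space d → ℂ),
    MemLp V q volume → Function.support V ⊆ Metric.closedBall x₀ R →
    expectedNormPow P ω h V 1 ≤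
      ENNReal.ofReal (C * Real.log (bracket R) ^ N) * eLpNorm V q volume

end KnappExample

end

/-! The obstruction is the Knapp example. Let `g` be the normalized indicator of a cap `K` about
`e₁` of radius comparable to `R^{-1/2}`, with measure `m ≳ R^{-(d-1)/2}`. On `T_R` the extension `ℰ
g` behaves like `√m · e^{2πi x·e₁}`: the phase `x·(η - e₁)` stays small for `x ∈ T_R`, `η ∈ K`
(`abs_inner_sub_pole_le`). If `h` is small, the phase `x·(e₁ - ξ)` also barely moves over one
lattice cube, for every `ξ` on the sphere. So each cube in the tube contributes to `ℰ^* V_ω ℰ g (ξ)`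
a term `ω_k a_k(ξ)` with `|a_k(ξ)| ≳ R^{-(d+1)/(2q)} √m h^d` (`norm_restriction_cube_ge`).

Randomness destroys cancellation between cubes: by Khinchine, `𝔼|∑ ω_k a_k(ξ)| ≳ (∑
|a_k(ξ)|²)^{1/2}`. The tube holds at least about `h^{-d} R^{(d+1)/2}` cubes, so the square sum is at
least a multiple of `h^d R^{1-(d+1)/q}`. Integrating in `ξ` and applying Cauchy–Schwarz on the
sphere gives the first moment bound `expectedNormPow_one_ge`; squaring gives (i).

Since `‖V_R‖_q ≤ 2^d`, a bound with logarithmic losses would force `R^{1-(d+1)/q}` to grow at most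
logarithmically, hence `q ≤ d + 1`. This is (iii), and (ii) is (iii) at one fixed small `h`. -/

namespace KnappExample

/-! ### A Khinchine inequality -/

section Khinchine

variable {Ω : Type*} [MeasurableSpace Ω] {P : Measure Ω}

/-- A centred random variable of unit variance whose fourth moment is at most `K`. -/
structure IsNormalized (P : Measure Ω) (X : Ω → ℝ) (K : ℝ) : Prop where
  memLp : MemLp X 4 P
  mean : ∫ w, X w ∂P = 0
  variance : ∫ w, X w ^ 2 ∂P = 1
  fourth : ∫ w, X w ^ 4 ∂P ≤ K

lemma memLp_four_gaussianReal : MemLp (id : ℝ → ℝ) 4 (gaussianReal 0 1) := by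
  simpa using memLp_id_gaussianReal (μ := 0) (v := 1) 4

lemma isNormalized_of_hasLaw_gaussianReal {X : Ω → ℝ} (hX : HasLaw X (gaussianReal 0 1) P) :
    IsNormalized P X (∫ x, x ^ 4 ∂(gaussianReal 0 1)) where
  memLp := by
    have h := memLp_four_gaussianReal
    rw [← hX.map_eq] at h
    exact h.comp_of_map hX.aemeasurable
  mean := by
    rw [hX.integral_eq, integral_id_gaussianReal]
  variance := by
    have h := variance_id_gaussianReal (μ := 0) (v := 1)
    rw [variance_eq_integral aemeasurable_id] at h
    have h2 := hX.integral_comp (f := fun x : ℝ => x ^ 2) (by fun_prop)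
    simp only [Function.comp_def] at h2
    rw [h2]
    simpa using h
  fourth := by
    have h2 := hX.integral_comp (f := fun x : ℝ => x ^ 4) (by fun_prop)
    simp only [Function.comp_def] at h2
    rw [h2]

lemma integral_symmetricBernoulli (f : ℝ → ℝ) :
    ∫ x, f x ∂symmetricBernoulli = (f 1 + f (-1)) / 2 := by
  unfold symmetricBernoulli
  rw [integral_add_measure, integral_smul_measure, integral_smul_measure]
  · simp; ring
  · exact (integrable_dirac (by simp)).smul_measure (by simp)
  · exact (integrable_dirac (by simp)).smul_measure (by simp)

lemma isNormalized_of_hasLaw_symmetricBernoulli [IsProbabilityMeasure P] {X : Ω → ℝ}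
    (hX : HasLaw X symmetricBernoulli P) : IsNormalized P X 1 where
  memLp := by
    have h : ∀ᵐ x ∂symmetricBernoulli, ‖x‖ ≤ 1 := by
      unfold symmetricBernoulli
      rw [ae_add_measure_iff]
      constructor <;> refine Measure.ae_smul_measure ?_ _ <;> rw [ae_dirac_eq] <;> simp
    have h' : ∀ᵐ w ∂P, ‖X w‖ ≤ 1 := by
      rw [← hX.map_eq] at h
      exact ae_of_ae_map hX.aemeasurable h
    exact MemLp.of_bound hX.aemeasurable.aestronglyMeasurable 1 h'
  mean := by
    rw [hX.integral_eq, integral_symmetricBernoulli]; norm_num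
  variance := by
    have h2 := hX.integral_comp (f := fun x : ℝ => x ^ 2) (by fun_prop)
    simp only [Function.comp_def] at h2
    rw [h2, integral_symmetricBernoulli]; norm_num
  fourth := by
    have h2 := hX.integral_comp (f := fun x : ℝ => x ^ 4) (by fun_prop)
    simp only [Function.comp_def] at h2
    rw [h2, integral_symmetricBernoulli]; norm_num

/-- A common bound for the fourth moments of the random coefficients. -/
noncomputable def fourthMoment : ℝ := 3 + ∫ x, x ^ 4 ∂(gaussianReal 0 1)

/-- The summand `3` supplies the hypothesis `3 ≤ K` of the Khinchine lemmas and covers the Bernoulli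
law, without evaluating the Gaussian fourth moment. -/
lemma three_le_fourthMoment : 3 ≤ fourthMoment := by
  have : 0 ≤ ∫ x, x ^ 4 ∂(gaussianReal 0 1) := integral_nonneg fun x => by positivity
  unfold fourthMoment; linarith

lemma IsNormalized.mono {X : Ω → ℝ} {K L : ℝ} (h : IsNormalized P X K) (hKL : K ≤ L) :
    IsNormalized P X L :=
  ⟨h.memLp, h.mean, h.variance, h.fourth.trans hKL⟩

lemma IsRandomCoefficients.isNormalized {d : ℕ} [IsProbabilityMeasure P]
    {ω : (Fin d → ℤ) → Ω → ℝ} (h : IsRandomCoefficients P ω) (k : Fin d → ℤ) :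
    IsNormalized P (ω k) fourthMoment := by
  rcases h.law k with hk | hk
  · exact (isNormalized_of_hasLaw_gaussianReal hk).mono (by unfold fourthMoment; linarith)
  · exact (isNormalized_of_hasLaw_symmetricBernoulli hk).mono
      (by linarith [three_le_fourthMoment])

lemma MemLp.integrable_pow_of_le_four [IsFiniteMeasure P] {X : Ω → ℝ} (hX : MemLp X 4 P)
    {n : ℕ} (hn : n ≤ 4) : Integrable (fun w => X w ^ n) P := by
  have h : MemLp X n P := hX.mono_exponent (by exact_mod_cast hn)
  have := h.integrable_norm_pow'
  refine this.mono' (hX.aestronglyMeasurable.pow n) (ae_of_all _ fun w => ?_)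
  simp

lemma IndepFun.integral_pow_mul_pow {X Y : Ω → ℝ} (h : IndepFun X Y P)
    (hX : AEMeasurable X P) (hY : AEMeasurable Y P) (m n : ℕ) :
    ∫ w, X w ^ m * Y w ^ n ∂P = (∫ w, X w ^ m ∂P) * ∫ w, Y w ^ n ∂P :=
  h.integral_fun_comp_mul_comp (f := fun x : ℝ => x ^ m) (g := fun x : ℝ => x ^ n) hX hY
    (by fun_prop) (by fun_prop)

lemma IndepFun.integrable_pow_mul_pow [IsFiniteMeasure P] {X Y : Ω → ℝ} (h : IndepFun X Y P)
    (hX : MemLp X 4 P) (hY : MemLp Y 4 P) {m n : ℕ} (hm : m ≤ 4) (hn : n ≤ 4) :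
    Integrable (fun w => X w ^ m * Y w ^ n) P :=
  (h.comp (φ := fun x : ℝ => x ^ m) (ψ := fun x : ℝ => x ^ n)
    (by fun_prop) (by fun_prop)).integrable_mul
    (MemLp.integrable_pow_of_le_four hX hm) (MemLp.integrable_pow_of_le_four hY hn)

variable {ι : Type*} [IsProbabilityMeasure P] {ω : ι → Ω → ℝ} {K : ℝ}

/-- The first, second and fourth moments of a sum of independent normalized variables. -/
lemma moments_sum (hi : iIndepFun ω P) (hω : ∀ k, IsNormalized P (ω k) K) (hK : 3 ≤ K)
    (a : ι → ℝ) (s : Finset ι) :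
    MemLp (fun w => ∑ k ∈ s, a k * ω k w) 4 P ∧
    ∫ w, (∑ k ∈ s, a k * ω k w) ∂P = 0 ∧
    ∫ w, (∑ k ∈ s, a k * ω k w) ^ 2 ∂P = ∑ k ∈ s, a k ^ 2 ∧
    ∫ w, (∑ k ∈ s, a k * ω k w) ^ 4 ∂P ≤ K * (∑ k ∈ s, a k ^ 2) ^ 2 := by
  classical
  induction s using Finset.induction_on with
  | empty => simp
  | insert i s his ih =>
    obtain ⟨hm, h1, h2, h4⟩ := ih
    set T : Ω → ℝ := fun w => ∑ k ∈ s, a k * ω k w with hT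
    have hind : IndepFun T (ω i) P := by
      have hmeas : ∀ k, AEMeasurable (ω k) P := fun k =>
        (hω k).memLp.aestronglyMeasurable.aemeasurable
      have h := hi.indepFun_finset₀ s {i} (by simpa using his) hmeas
      have hψ : Measurable fun x : ({i} : Finset ι) → ℝ => x ⟨i, by simp⟩ :=
        measurable_pi_apply _
      have := h.comp (φ := fun x : s → ℝ => ∑ k : s, a k * x k)
        (ψ := fun x : ({i} : Finset ι) → ℝ => x ⟨i, by simp⟩)
        (Finset.measurable_sum _ fun k _ => (measurable_pi_apply k).const_mul _)
        hψ
      convert this using 1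
      · ext w
        simp only [hT, Function.comp]
        rw [← Finset.sum_coe_sort s]
      · rfl
    have hN := hω i
    have hTm := hm.aestronglyMeasurable.aemeasurable
    have hXm := hN.memLp.aestronglyMeasurable.aemeasurable
    have hI : ∀ m n : ℕ, m ≤ 4 → n ≤ 4 → Integrable (fun w => T w ^ m * ω i w ^ n) P :=
      fun m n hm' hn' => IndepFun.integrable_pow_mul_pow hind hm hN.memLp hm' hn'
    have hE := IndepFun.integral_pow_mul_pow hind hTm hXm
    have hB : ∑ k ∈ insert i s, a k ^ 2 = a i ^ 2 + ∑ k ∈ s, a k ^ 2 :=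
      Finset.sum_insert his
    have hS : ∀ w, ∑ k ∈ insert i s, a k * ω k w = a i * ω i w + T w := fun w =>
      Finset.sum_insert his
    have hT1 : ∫ w, T w ^ 1 ∂P = 0 := by simpa using h1
    have hX1 : ∫ w, ω i w ^ 1 ∂P = 0 := by simpa using hN.mean
    simp only [hS, hB]
    refine ⟨(hN.memLp.const_mul (a i)).add hm, ?_, ?_, ?_⟩
    · rw [integral_add ((hN.memLp.integrable (by norm_num)).const_mul _)
        (hm.integrable (by norm_num)), integral_const_mul, hN.mean, h1]
      simp
    -- The zeroth powers give every term the form `T^m * X^n`, so that one factorization `hE` serves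
    -- them all.
    · have : ∀ w, (a i * ω i w + T w) ^ 2 = a i ^ 2 * (T w ^ 0 * ω i w ^ 2)
          + (2 * a i * (T w ^ 1 * ω i w ^ 1) + T w ^ 2 * ω i w ^ 0) := fun w => by ring
      simp only [this]
      have i1 := (hI 0 2 (by norm_num) (by norm_num)).const_mul (a i ^ 2)
      have i2 := (hI 1 1 (by norm_num) (by norm_num)).const_mul (2 * a i)
      have i3 := hI 2 0 (by norm_num) (by norm_num)
      have i23 : Integrable (fun w => 2 * a i * (T w ^ 1 * ω i w ^ 1) + T w ^ 2 * ω i w ^ 0) P :=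
        i2.add i3
      rw [integral_add i1 i23, integral_add i2 i3, integral_const_mul,
        integral_const_mul, hE, hE, hE, hX1, hN.variance, h2]
      simp
    · have : ∀ w, (a i * ω i w + T w) ^ 4 = a i ^ 4 * (T w ^ 0 * ω i w ^ 4)
          + (4 * a i ^ 3 * (T w ^ 1 * ω i w ^ 3) + (6 * a i ^ 2 * (T w ^ 2 * ω i w ^ 2)
          + (4 * a i * (T w ^ 3 * ω i w ^ 1) + T w ^ 4 * ω i w ^ 0))) := fun w => by ring
      simp only [this]
      have i1 := (hI 0 4 (by norm_num) (by norm_num)).const_mul (a i ^ 4)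
      have i2 := (hI 1 3 (by norm_num) (by norm_num)).const_mul (4 * a i ^ 3)
      have i3 := (hI 2 2 (by norm_num) (by norm_num)).const_mul (6 * a i ^ 2)
      have i4 := (hI 3 1 (by norm_num) (by norm_num)).const_mul (4 * a i)
      have i5 := hI 4 0 (by norm_num) (by norm_num)
      have i45 : Integrable (fun w => 4 * a i * (T w ^ 3 * ω i w ^ 1) + T w ^ 4 * ω i w ^ 0) P :=
        i4.add i5
      have i35 : Integrable (fun w => 6 * a i ^ 2 * (T w ^ 2 * ω i w ^ 2)
          + (4 * a i * (T w ^ 3 * ω i w ^ 1) + T w ^ 4 * ω i w ^ 0)) P := i3.add i45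
      have i25 : Integrable (fun w => 4 * a i ^ 3 * (T w ^ 1 * ω i w ^ 3)
          + (6 * a i ^ 2 * (T w ^ 2 * ω i w ^ 2)
          + (4 * a i * (T w ^ 3 * ω i w ^ 1) + T w ^ 4 * ω i w ^ 0))) P := i2.add i35
      rw [integral_add i1 i25, integral_add i2 i35, integral_add i3 i45, integral_add i4 i5, integral_const_mul,
        integral_const_mul, integral_const_mul, integral_const_mul, hE, hE, hE, hE, hE, hX1, hT1,
        hN.variance, h2]
      simp only [pow_zero, integral_const, probReal_univ, smul_eq_mul, mul_one, one_mul, zero_mul,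
        mul_zero, zero_add]
      set B := ∑ k ∈ s, a k ^ 2
      have hB0 : 0 ≤ B := Finset.sum_nonneg fun k _ => sq_nonneg _
      have e1 : a i ^ 4 * ∫ w, ω i w ^ 4 ∂P ≤ a i ^ 4 * K := by
        gcongr
        exact hN.fourth
      -- Terms with a first power vanish by centring. What remains is at most `K a⁴ + 6 a² B + K
      -- B²`, which is below `K (a² + B)²` exactly because `6 ≤ 2K`.
      have e2 : 0 ≤ (2 * K - 6) * (a i ^ 2 * B) := by
        have : 0 ≤ 2 * K - 6 := by linarith
        positivity
      nlinarith [h4]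

/-- A minorant of `|t|` by even powers, through which second and fourth moments control the first
absolute moment from below. It amounts to `1 - u + u³/4 ≥ 0` for `u = |t|`. -/
lemma sub_le_self_of_sq (t : ℝ) : t ^ 2 - t ^ 4 / 4 ≤ |t| := by
  have h : 0 ≤ |t| * (1 - |t| + |t| ^ 3 / 4) := by
    refine mul_nonneg (abs_nonneg t) ?_
    have := abs_nonneg t
    nlinarith [mul_nonneg this (sq_nonneg (|t| - 1)), sq_nonneg (|t| - 1), sq_nonneg (2 * |t| - 2)]
  have h2 : |t| ^ 2 = t ^ 2 := sq_abs t
  have h4 : |t| ^ 4 = t ^ 4 := by rw [show (4 : ℕ) = 2 * 2 by rfl, pow_mul, pow_mul, h2]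
  nlinarith

/-- The lower Khinchine inequality in `L¹`, for real coefficients. -/
lemma khinchine_real (hi : iIndepFun ω P) (hω : ∀ k, IsNormalized P (ω k) K) (hK : 3 ≤ K)
    (a : ι → ℝ) (s : Finset ι) :
    Real.sqrt (∑ k ∈ s, a k ^ 2) / (2 * K) ≤ ∫ w, |∑ k ∈ s, a k * ω k w| ∂P := by
  obtain ⟨hm, -, h2, h4⟩ := moments_sum hi hω hK a s
  set B := ∑ k ∈ s, a k ^ 2
  have hB0 : 0 ≤ B := Finset.sum_nonneg fun k _ => sq_nonneg _
  set S : Ω → ℝ := fun w => ∑ k ∈ s, a k * ω k w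
  rcases hB0.eq_or_lt with hB | hB
  · rw [← hB]; simp; exact integral_nonneg fun w => abs_nonneg _
  set A := Real.sqrt B
  have hA : 0 < A := Real.sqrt_pos.2 hB
  have hA2 : A ^ 2 = B := Real.sq_sqrt hB0
  have hK0 : 0 < K := by linarith
  -- The minorant is applied to `c S` and divided by `c`. At this scale the quadratic term gives `A
  -- / K` and the quartic one costs at most `A / (4K²)`, which leaves `A / (2K)`.
  set c := (K * A)⁻¹
  have hc : 0 < c := by positivity
  have hpt : ∀ w, c * S w ^ 2 - c ^ 3 / 4 * S w ^ 4 ≤ |S w| := fun w => by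
    have := sub_le_self_of_sq (c * S w)
    rw [abs_mul, abs_of_pos hc] at this
    have h' : c * (c * S w ^ 2 - c ^ 3 / 4 * S w ^ 4) ≤ c * |S w| := by
      refine le_trans (le_of_eq ?_) this
      ring
    exact le_of_mul_le_mul_left h' hc
  have i2 := (MemLp.integrable_pow_of_le_four hm (n := 2) (by norm_num)).const_mul c
  have i4 := (MemLp.integrable_pow_of_le_four hm (n := 4) (by norm_num)).const_mul (c ^ 3 / 4)
  have h := integral_mono (i2.sub i4) (hm.integrable (by norm_num)).abs hpt
  refine le_trans ?_ h
  simp only [Pi.sub_apply]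
  rw [integral_sub i2 i4, integral_const_mul, integral_const_mul, h2]
  have : c ^ 3 / 4 * ∫ w, S w ^ 4 ∂P ≤ c ^ 3 / 4 * (K * B ^ 2) := by gcongr
  refine le_trans ?_ (sub_le_sub_left this _)
  rw [← hA2]
  have e : c * A ^ 2 - c ^ 3 / 4 * (K * (A ^ 2) ^ 2) = A / K - A / (4 * K ^ 2) := by
    simp only [c]; field_simp
  rw [e]
  have e2 : A / K - A / (4 * K ^ 2) - A / (2 * K) = A * (2 * K - 1) / (4 * K ^ 2) := by
    field_simp; ring
  have : 0 ≤ A * (2 * K - 1) / (4 * K ^ 2) :=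
    div_nonneg (mul_nonneg hA.le (by linarith)) (by positivity)
  linarith

/-- The lower Khinchine inequality in `L¹`, for complex coefficients. -/
lemma khinchine_complex (hi : iIndepFun ω P) (hω : ∀ k, IsNormalized P (ω k) K) (hK : 3 ≤ K)
    (a : ι → ℂ) (s : Finset ι) :
    ENNReal.ofReal (Real.sqrt (∑ k ∈ s, ‖a k‖ ^ 2) / (4 * K)) ≤
      ∫⁻ w, ‖∑ k ∈ s, (ω k w : ℂ) * a k‖ₑ ∂P := by
  -- `b` will be the real or the imaginary parts, whichever carry at least half of the square sum.
  have key : ∀ b : ι → ℝ, (∀ w, |∑ k ∈ s, b k * ω k w| ≤ ‖∑ k ∈ s, (ω k w : ℂ) * a k‖) →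
      (∑ k ∈ s, ‖a k‖ ^ 2) / 2 ≤ ∑ k ∈ s, b k ^ 2 →
      ENNReal.ofReal (Real.sqrt (∑ k ∈ s, ‖a k‖ ^ 2) / (4 * K)) ≤
        ∫⁻ w, ‖∑ k ∈ s, (ω k w : ℂ) * a k‖ₑ ∂P := fun b hb hb2 => by
    have h := khinchine_real hi hω hK b s
    have hm := (moments_sum hi hω hK b s).1
    have hle : Real.sqrt (∑ k ∈ s, ‖a k‖ ^ 2) / (4 * K) ≤
        Real.sqrt (∑ k ∈ s, b k ^ 2) / (2 * K) := by
      have h1 : Real.sqrt (∑ k ∈ s, ‖a k‖ ^ 2) ≤ 2 * Real.sqrt (∑ k ∈ s, b k ^ 2) := by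
        rw [show (2 : ℝ) = Real.sqrt 4 by
          rw [show (4 : ℝ) = 2 ^ 2 by norm_num, Real.sqrt_sq (by norm_num)],
          ← Real.sqrt_mul (by norm_num)]
        refine Real.sqrt_le_sqrt ?_
        have : 0 ≤ ∑ k ∈ s, b k ^ 2 := Finset.sum_nonneg fun k _ => sq_nonneg _
        linarith
      have hK0 : 0 < K := by linarith
      rw [div_le_div_iff₀ (by positivity) (by positivity)]
      nlinarith
    calc _ ≤ ENNReal.ofReal (∫ w, |∑ k ∈ s, b k * ω k w| ∂P) :=
          ENNReal.ofReal_le_ofReal (hle.trans h)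
      _ = ∫⁻ w, ENNReal.ofReal |∑ k ∈ s, b k * ω k w| ∂P :=
          ofReal_integral_eq_lintegral_ofReal (hm.integrable (by norm_num)).abs
            (ae_of_all _ fun w => abs_nonneg _)
      _ ≤ _ := lintegral_mono fun w => by
          rw [← ofReal_norm]
          exact ENNReal.ofReal_le_ofReal (hb w)
  have hsum : ∑ k ∈ s, ‖a k‖ ^ 2 = ∑ k ∈ s, (a k).re ^ 2 + ∑ k ∈ s, (a k).im ^ 2 := by
    rw [← Finset.sum_add_distrib]
    refine Finset.sum_congr rfl fun k _ => ?_
    rw [← Complex.normSq_eq_norm_sq, Complex.normSq_apply]; ring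
  rcases le_total (∑ k ∈ s, (a k).re ^ 2) (∑ k ∈ s, (a k).im ^ 2) with hle | hle
  · refine key (fun k => (a k).im) (fun w => ?_) (by linarith)
    have : ∑ k ∈ s, (a k).im * ω k w = (∑ k ∈ s, (ω k w : ℂ) * a k).im := by
      simp [mul_comm]
    rw [this]; exact Complex.abs_im_le_norm _
  · refine key (fun k => (a k).re) (fun w => ?_) (by linarith)
    have : ∑ k ∈ s, (a k).re * ω k w = (∑ k ∈ s, (ω k w : ℂ) * a k).re := by
      simp [mul_comm]
    rw [this]; exact Complex.abs_re_le_norm _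

end Khinchine

/-! ### Boxes, lattice cubes, tubes and spherical caps -/

section Geometry

variable {d : ℕ}

lemma volume_box (s : Fin d → Set ℝ) (hs : ∀ i, MeasurableSet (s i)) :
    volume {x : Space d | ∀ i, x i ∈ s i} = ∏ i, volume (s i) := by
  have h := (EuclideanSpace.volume_preserving_symm_measurableEquiv_toLp (Fin d)).measure_preimage
    (MeasurableSet.univ_pi hs).nullMeasurableSet
  rw [volume_pi_pi] at h
  rw [← h]
  congr 1
  ext x
  simp [Set.mem_pi]

lemma measurableSet_box (s : Fin d → Set ℝ) (hs : ∀ i, MeasurableSet (s i)) :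
    MeasurableSet {x : Space d | ∀ i, x i ∈ s i} := by
  rw [Set.ofPred_forall]
  exact MeasurableSet.iInter fun i => (by fun_prop : Measurable fun x : Space d => x i) (hs i)

lemma norm_le_sum_abs (x : Space d) : ‖x‖ ≤ ∑ i, |x i| := by
  rw [EuclideanSpace.norm_eq]
  refine Real.sqrt_le_iff.2 ⟨Finset.sum_nonneg fun i _ => abs_nonneg _, ?_⟩
  simpa using Finset.sum_sq_le_sq_sum_of_nonneg (s := Finset.univ) (f := fun i => ‖x i‖)
    fun i _ => norm_nonneg _

lemma latticeCube_eq_box {h : ℝ} (hh : 0 < h) (k : Fin d → ℤ) :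
    latticeCube h k = {x : Space d | ∀ i, x i ∈ Set.Ico (h * k i) (h * k i + h)} := by
  ext x
  simp only [latticeCube, Set.mem_ofPred_eq, Set.mem_Ico]
  refine forall_congr' fun i => ?_
  rw [le_div_iff₀ hh, div_lt_iff₀ hh]
  constructor <;> rintro ⟨h1, h2⟩ <;> constructor <;> linarith

lemma measurableSet_latticeCube {h : ℝ} (hh : 0 < h) (k : Fin d → ℤ) :
    MeasurableSet (latticeCube h k : Set (Space d)) := by
  rw [latticeCube_eq_box hh]
  exact measurableSet_box _ fun i => measurableSet_Ico

lemma volume_latticeCube {h : ℝ} (hh : 0 < h) (k : Fin d → ℤ) :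
    volume (latticeCube h k : Set (Space d)) = ENNReal.ofReal (h ^ d) := by
  rw [latticeCube_eq_box hh, volume_box _ fun i => measurableSet_Ico]
  simp [ENNReal.ofReal_pow hh.le]

/-- The lattice point `h k`. -/
noncomputable def latticePoint (h : ℝ) (k : Fin d → ℤ) : Space d :=
  WithLp.toLp 2 fun i => h * (k i : ℝ)

lemma norm_sub_latticePoint_le {h : ℝ} (hh : 0 < h) {k : Fin d → ℤ} {x : Space d}
    (hx : x ∈ latticeCube h k) : ‖x - latticePoint h k‖ ≤ d * h := by
  rw [latticeCube_eq_box hh] at hx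
  refine (norm_le_sum_abs _).trans ?_
  have : ∀ i ∈ Finset.univ, |(x - latticePoint h k) i| ≤ h := fun i _ => by
    have := hx i
    simp only [Set.mem_Ico] at this
    rw [show (x - latticePoint h k) i = x i - h * k i from rfl, abs_le]
    constructor <;> linarith [this.1, this.2]
  simpa using Finset.sum_le_card_nsmul _ _ _ this

variable [NeZero d]

lemma inner_eq_add_sum_erase (x y : Space d) :
    inner ℝ x y = x 0 * y 0 + ∑ i ∈ Finset.univ.erase 0, x i * y i := by
  rw [PiLp.inner_apply, ← Finset.add_sum_erase _ _ (Finset.mem_univ (0 : Fin d))]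
  simp [mul_comm]

lemma norm_sq_eq_add_sum_erase (x : Space d) :
    ‖x‖ ^ 2 = x 0 ^ 2 + ∑ i ∈ Finset.univ.erase 0, x i ^ 2 := by
  rw [← real_inner_self_eq_norm_sq, inner_eq_add_sum_erase]
  simp [sq]

/-- The centre `e₁` of the spherical caps. -/
noncomputable def pole (d : ℕ) [NeZero d] : Space d := EuclideanSpace.single 0 1

lemma norm_pole : ‖pole d‖ = 1 := by simp [pole]

/-- The spherical cap `{ξ : ξ₁ > 0, |ξ'| ≤ r}`. -/
def cap (d : ℕ) [NeZero d] (r : ℝ) : Set (USphere d) :=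
  {ξ | 0 < (ξ : Space d) 0 ∧ ∑ i ∈ Finset.univ.erase 0, (ξ : Space d) i ^ 2 ≤ r ^ 2}

lemma measurableSet_cap (r : ℝ) : MeasurableSet (cap d r) := by
  have h : ∀ i, Measurable fun ξ : USphere d => (ξ : Space d) i := fun i =>
    (by fun_prop : Measurable fun x : Space d => x i).comp measurable_subtype_coe
  exact (measurableSet_lt measurable_const (h 0)).inter
    (measurableSet_le (Finset.measurable_sum _ fun i _ => (h i).pow_const 2) measurable_const)

/-- On the tube `T_R` the phase `x · (η - e₁)` varies little over a cap of radius `R^{-1/2}`. -/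
lemma abs_inner_sub_pole_le {R : ℝ} (hR : 0 < R) {x : Space d} (hx : x ∈ tube d R)
    {η : USphere d} (hη : η ∈ cap d (1 / 16 / Real.sqrt R)) :
    |inner ℝ x ((η : Space d) - pole d)| ≤ 1 / 12 := by
  obtain ⟨hx0, hx1⟩ := hx
  obtain ⟨hη0, hη1⟩ := hη
  set s := Real.sqrt R
  have hs : 0 < s := Real.sqrt_pos.2 hR
  have hs2 : s ^ 2 = R := Real.sq_sqrt hR.le
  have hn := norm_sq_eq_add_sum_erase (η : Space d)
  rw [norm_eq_of_mem_sphere] at hn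
  have hsum : ∑ i ∈ Finset.univ.erase 0, x i * ((η : Space d) - pole d) i
      = ∑ i ∈ Finset.univ.erase 0, x i * (η : Space d) i := by
    refine Finset.sum_congr rfl fun i hi => ?_
    have : pole d i = 0 := by simp [pole, Finset.ne_of_mem_erase hi]
    simp [this]
  rw [inner_eq_add_sum_erase, hsum]
  have hp0 : ((η : Space d) - pole d) 0 = (η : Space d) 0 - 1 := by simp [pole]
  rw [hp0]
  set B := ∑ i ∈ Finset.univ.erase 0, (η : Space d) i ^ 2
  set t := (η : Space d) 0
  have hB0 : 0 ≤ B := Finset.sum_nonneg fun i _ => sq_nonneg _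
  have ht1 : t ≤ 1 := by nlinarith
  have hcs := Finset.sum_mul_sq_le_sq_mul_sq (Finset.univ.erase (0 : Fin d)) (fun i => x i)
    fun i => (η : Space d) i
  set A := ∑ i ∈ Finset.univ.erase 0, x i ^ 2
  have hA0 : 0 ≤ A := Finset.sum_nonneg fun i _ => sq_nonneg _
  have hAR : A ≤ s ^ 2 := by
    have := Real.lt_sqrt (Real.sqrt_nonneg A) |>.1 hx1
    rw [Real.sq_sqrt hA0] at this
    linarith
  have h1 : |∑ i ∈ Finset.univ.erase 0, x i * (η : Space d) i| ≤ 1 / 16 := by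
    refine abs_le_of_sq_le_sq (hcs.trans ?_) (by norm_num)
    calc A * B ≤ s ^ 2 * (1 / 16 / s) ^ 2 := by gcongr
      _ = _ := by field_simp
  -- Curvature enters here: `1 - η₁ ≤ 1 - η₁² = |η'|²` is quadratic in the cap radius, so the tube
  -- may have length `R` although its width is only `R^{1/2}`.
  have h2 : |x 0 * (t - 1)| ≤ 1 / 256 := by
    rw [abs_mul, abs_of_nonpos (by linarith : t - 1 ≤ 0)]
    have : -(t - 1) ≤ B := by nlinarith
    calc |x 0| * (-(t - 1)) ≤ s ^ 2 * (1 / 16 / s) ^ 2 := by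
          rw [hs2]
          exact mul_le_mul hx0.le (this.trans hη1) (by linarith) hR.le
      _ = _ := by field_simp; norm_num
  have := abs_add_le (x 0 * (t - 1)) (∑ i ∈ Finset.univ.erase 0, x i * (η : Space d) i)
  linarith

/-- Lower bound for the surface measure of a cap. -/
lemma surfaceMeasure_cap_ge {r : ℝ} (hr : 0 < r) (hr1 : r ≤ 1) :
    ENNReal.ofReal (1 / 4 * (r / (2 * d)) ^ (d - 1)) ≤ surfaceMeasure d (cap d r) := by
  have hd : 0 < d := Nat.pos_of_ne_zero (NeZero.ne d)
  have hd1 : (1 : ℝ) ≤ d := by exact_mod_cast hd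
  set ρ := r / (4 * d) with hρ
  have hρ0 : 0 < ρ := by positivity
  have hρd : d * ρ = r / 4 := by rw [hρ]; field_simp
  -- `toSphere` is `d` times the volume of the cone over the cap, and this box lies in that cone:
  -- its points have norm in `(1/4, 1)`, so normalizing enlarges transverse coordinates at most
  -- fourfold, to `4ρ = r / d`.
  let s : Fin d → Set ℝ := fun i => if i = 0 then Set.Ioo (1 / 4) (1 / 2) else Set.Ioo (-ρ) ρ
  have hs : ∀ i, MeasurableSet (s i) := fun i => by
    by_cases h : i = 0 <;> simp [s, h]
  have hvol : volume {x : Space d | ∀ i, x i ∈ s i}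
      = ENNReal.ofReal (1 / 4 * (r / (2 * d)) ^ (d - 1)) := by
    rw [volume_box s hs, ← Finset.mul_prod_erase _ _ (Finset.mem_univ (0 : Fin d))]
    have : ∀ i ∈ Finset.univ.erase (0 : Fin d), volume (s i) = ENNReal.ofReal (r / (2 * d)) := by
      intro i hi
      simp only [s, Finset.ne_of_mem_erase hi, if_false, Real.volume_Ioo]
      congr 1
      rw [hρ]; field_simp; norm_num
    rw [Finset.prod_congr rfl this, Finset.prod_const, Finset.card_erase_of_mem (Finset.mem_univ _),
      Finset.card_univ, Fintype.card_fin, ENNReal.ofReal_mul (by norm_num),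
      ENNReal.ofReal_pow (by positivity)]
    simp only [s, if_true, Real.volume_Ioo]
    norm_num
  rw [← hvol, surfaceMeasure, Measure.toSphere_apply' _ (measurableSet_cap r), finrank_euclideanSpace,
    Fintype.card_fin]
  refine le_trans (measure_mono fun y hy => ?_) (le_mul_of_one_le_left zero_le
    (by exact_mod_cast hd))
  have hy0 : 1 / 4 < y 0 ∧ y 0 < 1 / 2 := by simpa [s] using hy 0
  have hyi : ∀ i ∈ Finset.univ.erase (0 : Fin d), |y i| ≤ ρ := fun i hi => by
    have := hy i
    simp only [s, Finset.ne_of_mem_erase hi, if_false, Set.mem_Ioo] at this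
    exact (abs_lt.2 this).le
  have hcard : ((Finset.univ.erase (0 : Fin d)).card : ℝ) ≤ d := by
    exact_mod_cast (Finset.card_le_univ _).trans (by simp)
  have hnlt : ‖y‖ < 1 := by
    refine (norm_le_sum_abs y).trans_lt ?_
    rw [← Finset.add_sum_erase _ _ (Finset.mem_univ (0 : Fin d)), abs_of_pos (by linarith [hy0.1])]
    have := Finset.sum_le_card_nsmul _ _ _ hyi
    rw [nsmul_eq_mul] at this
    have h2 : ((Finset.univ.erase (0 : Fin d)).card : ℝ) * ρ ≤ d * ρ := by gcongr
    linarith [hy0.2]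
  have hngt : 1 / 4 < ‖y‖ := by
    have := PiLp.norm_apply_le y 0
    rw [Real.norm_eq_abs] at this
    exact hy0.1.trans_le ((le_abs_self _).trans this)
  have hn0 : 0 < ‖y‖ := by linarith
  refine Set.mem_smul.2 ⟨‖y‖, ⟨hn0, hnlt⟩, ‖y‖⁻¹ • y, ?_, smul_inv_smul₀ hn0.ne' y⟩
  refine ⟨⟨‖y‖⁻¹ • y, by simp [norm_smul, hn0.ne']⟩, ⟨?_, ?_⟩, rfl⟩
  · have : 0 < y 0 := by linarith [hy0.1]
    simpa using mul_pos (inv_pos.2 hn0) this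
  · have hle : ∀ i ∈ Finset.univ.erase (0 : Fin d), (‖y‖⁻¹ • y) i ^ 2 ≤ (4 * ρ) ^ 2 := by
      intro i hi
      rw [PiLp.smul_apply, smul_eq_mul, sq_le_sq, abs_mul, abs_of_pos (inv_pos.2 hn0),
        abs_of_pos (by positivity : 0 < 4 * ρ)]
      have : ‖y‖⁻¹ ≤ 4 := by
        rw [inv_le_comm₀ hn0 (by norm_num)]; linarith
      exact mul_le_mul this (hyi i hi) (abs_nonneg _) (by norm_num)
    have := Finset.sum_le_card_nsmul _ _ _ hle
    rw [nsmul_eq_mul] at this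
    refine this.trans ?_
    calc ((Finset.univ.erase (0 : Fin d)).card : ℝ) * (4 * ρ) ^ 2 ≤ d * (4 * ρ) ^ 2 := by gcongr
      _ ≤ d * d * (4 * ρ) ^ 2 := by
          gcongr
          nlinarith
      _ = (4 * (d * ρ)) ^ 2 := by ring
      _ = r ^ 2 := by rw [hρd]; ring

lemma measurableSet_tube (R : ℝ) : MeasurableSet (tube d R) := by
  have h : ∀ i, Measurable fun x : Space d => x i := fun i => by fun_prop
  have hs : Measurable fun x : Space d => Real.sqrt (∑ i ∈ Finset.univ.erase 0, x i ^ 2) :=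
    (Finset.measurable_sum _ fun i _ => (h i).pow_const 2).sqrt
  exact (measurableSet_lt (h 0).abs measurable_const).inter
    (measurableSet_lt hs measurable_const)

lemma abs_lt_sqrt_of_mem_tube {R : ℝ} {x : Space d} (hx : x ∈ tube d R) {i : Fin d}
    (hi : i ≠ 0) : |x i| < Real.sqrt R := by
  refine lt_of_le_of_lt ?_ hx.2
  rw [← Real.sqrt_sq_eq_abs]
  exact Real.sqrt_le_sqrt (Finset.single_le_sum (f := fun i => x i ^ 2) (fun j _ => sq_nonneg _)
    (Finset.mem_erase.2 ⟨hi, Finset.mem_univ i⟩))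

lemma sqrt_le_self_of_one_le {R : ℝ} (hR : 1 ≤ R) : Real.sqrt R ≤ R :=
  Real.sqrt_le_iff.2 ⟨by linarith, by nlinarith⟩

lemma abs_lt_of_mem_tube {R : ℝ} (hR : 1 ≤ R) {x : Space d} (hx : x ∈ tube d R) (i : Fin d) :
    |x i| < R := by
  by_cases hi : i = 0
  · rw [hi]; exact hx.1
  · exact (abs_lt_sqrt_of_mem_tube hx hi).trans_le (sqrt_le_self_of_one_le hR)

lemma tube_subset_closedBall {R : ℝ} (hR : 1 ≤ R) :
    tube d R ⊆ Metric.closedBall (0 : Space d) (2 * R) := by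
  intro x hx
  rw [mem_closedBall_zero_iff]
  refine abs_le_of_sq_le_sq' ?_ (by linarith) |>.2
  rw [norm_sq_eq_add_sum_erase]
  have h1 : x 0 ^ 2 ≤ R ^ 2 := sq_le_sq' (by linarith [(abs_lt.1 hx.1).1]) (abs_lt.1 hx.1).2.le
  have h2 := Real.lt_sqrt (Real.sqrt_nonneg _) |>.1 hx.2
  rw [Real.sq_sqrt (Finset.sum_nonneg fun i _ => sq_nonneg _)] at h2
  nlinarith

/-- Upper bound for the volume of the tube. -/
lemma volume_tube_le {R : ℝ} (hR : 1 ≤ R) :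
    volume (tube d R) ≤ ENNReal.ofReal (2 ^ d * R ^ (((d : ℝ) + 1) / 2)) := by
  have hd : 0 < d := Nat.pos_of_ne_zero (NeZero.ne d)
  have hR0 : 0 < R := by linarith
  let s : Fin d → Set ℝ := fun i =>
    if i = 0 then Set.Ioo (-R) R else Set.Ioo (-Real.sqrt R) (Real.sqrt R)
  have hs : ∀ i, MeasurableSet (s i) := fun i => by
    by_cases h : i = 0 <;> simp [s, h]
  have hsub : tube d R ⊆ {x : Space d | ∀ i, x i ∈ s i} := fun x hx i => by
    by_cases hi : i = 0
    · simp only [s, hi, if_true]; exact abs_lt.1 hx.1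
    · simp only [s, hi, if_false]; exact abs_lt.1 (abs_lt_sqrt_of_mem_tube hx hi)
  refine (measure_mono hsub).trans (le_of_eq ?_)
  rw [volume_box s hs, ← Finset.mul_prod_erase _ _ (Finset.mem_univ (0 : Fin d))]
  have : ∀ i ∈ Finset.univ.erase (0 : Fin d), volume (s i) = ENNReal.ofReal (2 * Real.sqrt R) := by
    intro i hi
    simp only [s, Finset.ne_of_mem_erase hi, if_false, Real.volume_Ioo]
    congr 1
    ring
  rw [Finset.prod_congr rfl this, Finset.prod_const, Finset.card_erase_of_mem (Finset.mem_univ _),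
    Finset.card_univ, Fintype.card_fin, ← ENNReal.ofReal_pow (by positivity)]
  simp only [s, if_true, Real.volume_Ioo]
  rw [← ENNReal.ofReal_mul (by linarith)]
  congr 1
  obtain ⟨n, rfl⟩ : ∃ n, d = n + 1 := ⟨d - 1, by omega⟩
  have e : ((((n + 1 : ℕ) : ℝ) + 1) / 2) = 1 + 1 / 2 * n := by push_cast; ring
  rw [e, Real.rpow_add hR0, Real.rpow_one, Real.rpow_mul hR0.le, ← Real.sqrt_eq_rpow,
    Real.rpow_natCast, Nat.add_sub_cancel, mul_pow]
  ring

/-- Finitely many lattice cubes cover the tube. -/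
lemma exists_finset_disjoint_tube {h R : ℝ} (hh : 0 < h) (hR : 1 ≤ R) :
    ∃ F : Finset (Fin d → ℤ), ∀ k ∉ F, Disjoint (latticeCube h k) (tube d R) := by
  classical
  refine ⟨Fintype.piFinset fun _ => Finset.Icc (-(⌈R / h⌉ + 1)) (⌈R / h⌉ + 1), fun k hk => ?_⟩
  rw [Set.disjoint_left]
  intro x hx hxT
  refine hk (Fintype.mem_piFinset.2 fun i => ?_)
  rw [latticeCube_eq_box hh] at hx
  obtain ⟨h1, h2⟩ := hx i
  obtain ⟨h3, h4⟩ := abs_lt.1 (abs_lt_of_mem_tube hR hxT i)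
  have hc := Int.le_ceil (R / h)
  have hc' : R ≤ ⌈R / h⌉ * h := by rwa [div_le_iff₀ hh] at hc
  rw [Finset.mem_Icc]
  constructor
  · have : (-(⌈R / h⌉ + 1 : ℝ)) < k i := by
      by_contra! hcon
      nlinarith
    exact_mod_cast this.le
  · have : (k i : ℝ) < ⌈R / h⌉ + 1 := by
      by_contra! hcon
      nlinarith
    exact_mod_cast this.le

lemma half_le_floor {x : ℝ} (hx : 1 ≤ x) : x / 2 ≤ (⌊x⌋ : ℝ) := by
  have h1 : (1 : ℤ) ≤ ⌊x⌋ := Int.le_floor.2 (by exact_mod_cast hx)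
  have h2 : (1 : ℝ) ≤ ⌊x⌋ := by exact_mod_cast h1
  have := Int.lt_floor_add_one x
  linarith

/-- The tube `T_R` contains at least `c h^{-d} R^{(d+1)/2}` lattice cubes of side `h`. -/
lemma exists_finset_subset_tube {h R : ℝ} (hh : 0 < h) (hh1 : d * h ≤ 1) (hR : 1 ≤ R) :
    ∃ F : Finset (Fin d → ℤ), (∀ k ∈ F, latticeCube h k ⊆ tube d R) ∧
      R / 2 * (Real.sqrt R / (2 * d)) ^ (d - 1) ≤ F.card * h ^ d := by
  classical
  have hd : 0 < d := Nat.pos_of_ne_zero (NeZero.ne d)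
  have hd1 : (1 : ℝ) ≤ d := by exact_mod_cast hd
  have hR0 : 0 < R := by linarith
  set s := Real.sqrt R with hs
  have hs1 : 1 ≤ s := Real.one_le_sqrt.2 hR
  have hs2 : s ^ 2 = R := Real.sq_sqrt hR0.le
  have hh2 : h ≤ 1 := by nlinarith
  -- Cubes are packed into a box in the nonnegative orthant. Transverse side `√R / d` keeps the `d -
  -- 1` squares below `R` in total, and `d * h ≤ 1` gives `u i ≥ 1`, so that rounding down loses at
  -- most a factor `2`.
  let u : Fin d → ℝ := fun i => if i = 0 then R / h else s / (d * h)
  have hu : ∀ i, 1 ≤ u i := fun i => by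
    by_cases hi : i = 0
    · simp only [u, hi, if_true]; rw [le_div_iff₀ hh]; linarith
    · simp only [u, hi, if_false]; rw [le_div_iff₀ (by positivity)]; linarith
  refine ⟨Fintype.piFinset fun i => Finset.Ico 0 ⌊u i⌋, fun k hk x hx => ?_, ?_⟩
  · rw [latticeCube_eq_box hh] at hx
    have hb : ∀ i, 0 ≤ x i ∧ x i < h * u i := fun i => by
      obtain ⟨h1, h2⟩ := hx i
      obtain ⟨h3, h4⟩ := Finset.mem_Ico.1 (Fintype.mem_piFinset.1 hk i)
      have h3' : (0 : ℝ) ≤ k i := by exact_mod_cast h3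
      have h4' : (k i : ℝ) + 1 ≤ ⌊u i⌋ := by exact_mod_cast h4
      have := Int.floor_le (u i)
      constructor <;> nlinarith
    constructor
    · obtain ⟨h1, h2⟩ := hb 0
      rw [abs_of_nonneg h1]
      simp only [u, if_true] at h2
      rwa [mul_div_cancel₀ _ hh.ne'] at h2
    · refine Real.sqrt_lt_sqrt (Finset.sum_nonneg fun i _ => sq_nonneg _) ?_
      have hle : ∀ i ∈ Finset.univ.erase (0 : Fin d), x i ^ 2 ≤ R / d ^ 2 := fun i hi => by
        obtain ⟨h1, h2⟩ := hb i
        simp only [u, Finset.ne_of_mem_erase hi, if_false] at h2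
        have e : h * (s / (d * h)) = s / d := by field_simp
        rw [e] at h2
        calc x i ^ 2 ≤ (s / d) ^ 2 := by gcongr
          _ = _ := by rw [div_pow, hs2]
      have := Finset.sum_le_card_nsmul _ _ _ hle
      rw [nsmul_eq_mul, Finset.card_erase_of_mem (Finset.mem_univ _), Finset.card_univ,
        Fintype.card_fin, Nat.cast_sub hd, Nat.cast_one] at this
      refine this.trans_lt ?_
      rw [mul_div_assoc', div_lt_iff₀ (by positivity), mul_comm R]
      exact mul_lt_mul_of_pos_right (by nlinarith) hR0
  · rw [Fintype.card_piFinset]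
    push_cast
    have hcard : ∀ i, u i / 2 ≤ ((Finset.Ico (0 : ℤ) ⌊u i⌋).card : ℝ) := fun i => by
      have h1 : (0 : ℤ) ≤ ⌊u i⌋ := Int.floor_nonneg.2 (by linarith [hu i])
      have h2 : (((Finset.Ico (0 : ℤ) ⌊u i⌋).card : ℤ) : ℝ) = ⌊u i⌋ := by
        rw [Int.card_Ico, sub_zero, Int.toNat_of_nonneg h1]
      rw [Int.cast_natCast] at h2
      rw [h2]
      exact half_le_floor (hu i)
    have hprod : ∏ i, u i / 2 ≤ ∏ i, ((Finset.Ico (0 : ℤ) ⌊u i⌋).card : ℝ) :=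
      Finset.prod_le_prod (fun i _ => by linarith [hu i]) fun i _ => hcard i
    have he : (∏ i, u i / 2) * h ^ d = R / 2 * (s / (2 * d)) ^ (d - 1) := by
      rw [← Finset.mul_prod_erase _ _ (Finset.mem_univ (0 : Fin d))]
      have : ∀ i ∈ Finset.univ.erase (0 : Fin d), u i / 2 = s / (d * h) / 2 := fun i hi => by
        simp only [u, Finset.ne_of_mem_erase hi, if_false]
      rw [Finset.prod_congr rfl this, Finset.prod_const,
        Finset.card_erase_of_mem (Finset.mem_univ _), Finset.card_univ, Fintype.card_fin]
      simp only [u, if_true]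
      have e : h ^ d = h * h ^ (d - 1) := by rw [← pow_succ', Nat.sub_add_cancel hd]
      rw [e]
      have e2 : s / (d * h) / 2 = s / (2 * d) / h := by field_simp
      rw [e2, div_pow _ h]
      field_simp
    rw [← he]
    gcongr

end Geometry

/-! ### The Knapp example -/

section Knapp

variable {d : ℕ}

instance : IsFiniteMeasure (surfaceMeasure d) := by
  unfold surfaceMeasure; infer_instance

/-- The character `e^{2πi t}`. -/
noncomputable def phase (t : ℝ) : ℂ := Complex.exp (2 * Real.pi * Complex.I * t)

lemma phase_add (s t : ℝ) : phase (s + t) = phase s * phase t := by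
  rw [phase, phase, phase, ← Complex.exp_add]; congr 1; push_cast; ring

lemma phase_eq (t : ℝ) : phase t = Complex.exp ((2 * Real.pi * t : ℝ) * Complex.I) := by
  rw [phase]; congr 1; push_cast; ring

lemma norm_phase (t : ℝ) : ‖phase t‖ = 1 := by
  rw [phase_eq, Complex.norm_exp_ofReal_mul_I]

lemma continuous_phase : Continuous phase := by
  unfold phase; fun_prop

/-- The phase budget `1/6` is later split evenly: `1/12` for variation over the cap, `1/12` for
variation over a lattice cube. -/
lemma half_le_re_phase {t : ℝ} (ht : |t| ≤ 1 / 6) : 1 / 2 ≤ (phase t).re := by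
  rw [phase_eq, Complex.exp_ofReal_mul_I_re, ← Real.cos_pi_div_three, ← Real.cos_abs (2 * _ * _)]
  have hpi := Real.pi_pos
  have h : |2 * Real.pi * t| ≤ Real.pi / 3 := by
    rw [abs_mul, abs_of_pos (by positivity)]
    nlinarith
  exact Real.cos_le_cos_of_nonneg_of_le_pi (abs_nonneg _) (by linarith) h

lemma restriction_eq (F : Space d → ℂ) (ξ : USphere d) :
    restriction F ξ = ∫ x, phase (-inner ℝ x (ξ : Space d)) * F x := by
  rw [restriction, Real.fourier_eq']
  refine integral_congr_ae (ae_of_all _ fun x => ?_)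
  simp only [phase_eq, smul_eq_mul]
  congr 3
  ring_nf

lemma continuous_restriction {F : Space d → ℂ} (hF : Integrable F) : Continuous (restriction F) :=
  (VectorFourier.fourierIntegral_continuous (L := innerₗ (Space d)) Real.continuous_fourierChar
    (by exact continuous_inner) hF).comp continuous_subtype_val

/-- The extension of the indicator function of a set. -/
noncomputable def wave (K : Set (USphere d)) (x : Space d) : ℂ :=
  ∫ η in K, phase (inner ℝ x (η : Space d)) ∂surfaceMeasure d

lemma integrable_phase_comp {f : USphere d → ℝ} (hf : Continuous f) (K : Set (USphere d)) :
    Integrable (fun η => phase (f η)) ((surfaceMeasure d).restrict K) :=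
  Integrable.of_bound (continuous_phase.comp hf).aestronglyMeasurable 1
    (ae_of_all _ fun _ => (norm_phase _).le)

lemma continuous_wave (K : Set (USphere d)) : Continuous (wave K) := by
  refine continuous_of_dominated (bound := fun _ => 1) (fun x => ?_) (fun x => ?_)
    (integrable_const _) (ae_of_all _ fun η => ?_)
  · exact (integrable_phase_comp (by fun_prop) K).aestronglyMeasurable
  · exact ae_of_all _ fun η => (norm_phase _).le
  · exact continuous_phase.comp (by fun_prop)

lemma norm_wave_le (K : Set (USphere d)) (x : Space d) :
    ‖wave K x‖ ≤ (surfaceMeasure d).real K := by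
  have := norm_setIntegral_le_of_norm_le_const (μ := surfaceMeasure d) (s := K) (C := 1)
    (f := fun η : USphere d => phase (inner ℝ x (η : Space d))) (measure_lt_top _ _)
    fun η _ => (norm_phase _).le
  simpa [wave] using this

/-- The `L²`-normalized indicator function of a set. -/
noncomputable def normalizedIndicator {K : Set (USphere d)} (hK : MeasurableSet K) :
    Lp ℂ 2 (surfaceMeasure d) :=
  indicatorConstLp 2 hK (measure_ne_top _ _)
    (((Real.sqrt ((surfaceMeasure d).real K))⁻¹ : ℝ) : ℂ)

/-- The inequality also covers null sets, where the inverse square root is `0` by convention. -/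
lemma norm_normalizedIndicator_le {K : Set (USphere d)} (hK : MeasurableSet K) :
    ‖normalizedIndicator hK‖ ≤ 1 := by
  rw [normalizedIndicator, norm_indicatorConstLp (by norm_num) (by norm_num), Complex.norm_real,
    Real.norm_of_nonneg (by positivity)]
  simp only [ENNReal.toReal_ofNat, ← Real.sqrt_eq_rpow]
  exact inv_mul_le_one

lemma extension_normalizedIndicator {K : Set (USphere d)} (hK : MeasurableSet K) (x : Space d) :
    extension (fun ξ => normalizedIndicator hK ξ) x =
      (((Real.sqrt ((surfaceMeasure d).real K))⁻¹ : ℝ) : ℂ) * wave K x := by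
  set c := (((Real.sqrt ((surfaceMeasure d).real K))⁻¹ : ℝ) : ℂ)
  have h : (fun ξ : USphere d => phase (inner ℝ x (ξ : Space d)) * normalizedIndicator hK ξ)
      =ᵐ[surfaceMeasure d]
      K.indicator fun ξ => c * phase (inner ℝ x (ξ : Space d)) := by
    filter_upwards [indicatorConstLp_coeFn (p := 2) (hs := hK) (c := c)
      (hμs := measure_ne_top (surfaceMeasure d) K)] with ξ hξ
    rw [normalizedIndicator, hξ]
    by_cases hm : ξ ∈ K <;> simp [hm, mul_comm]
  calc extension (fun ξ => normalizedIndicator hK ξ) x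
      = ∫ ξ : USphere d, phase (inner ℝ x (ξ : Space d)) * normalizedIndicator hK ξ
          ∂surfaceMeasure d := rfl
    _ = c * wave K x := by
      rw [integral_congr_ae h, integral_indicator hK, integral_const_mul, wave]

lemma eLpNorm_restriction_le_sandwichNorm (V : Space d → ℂ) {K : Set (USphere d)}
    (hK : MeasurableSet K) :
    eLpNorm (restriction fun x =>
      V x * ((((Real.sqrt ((surfaceMeasure d).real K))⁻¹ : ℝ) : ℂ) * wave K x)) 2
      (surfaceMeasure d) ≤ sandwichNorm V := by
  simp only [← extension_normalizedIndicator hK]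
  exact le_iSup₂_of_le (f := fun (g : Lp ℂ 2 (surfaceMeasure d)) (_ : ‖g‖ ≤ 1) =>
    eLpNorm (restriction (fun x => V x * extension (fun ξ => g ξ) x)) 2 (surfaceMeasure d))
    (normalizedIndicator hK) (norm_normalizedIndicator_le hK) le_rfl

/-- Cubes missing the support contribute nothing, which reduces the series to the finite sums that
Khinchine handles. -/
lemma randomize_eq_sum {h : ℝ} {V : Space d → ℂ} {F : Finset (Fin d → ℤ)}
    (hF : ∀ k ∉ F, Disjoint (latticeCube h k) (Function.support V)) (ω : (Fin d → ℤ) → ℝ)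
    (x : Space d) :
    randomize h ω V x = ∑ k ∈ F, (ω k : ℂ) * (latticeCube h k).indicator V x := by
  refine tsum_eq_sum fun k hk => ?_
  by_cases hx : x ∈ latticeCube h k
  · have : V x = 0 := by
      by_contra hV
      exact Set.disjoint_left.1 (hF k hk) hx hV
    simp [this]
  · simp [hx]

lemma restriction_sum {ι : Type*} (F : Finset ι) (c : ι → ℂ) {f : ι → Space d → ℂ}
    (hf : ∀ k ∈ F, Integrable (f k)) (ξ : USphere d) :
    restriction (fun x => ∑ k ∈ F, c k * f k x) ξ = ∑ k ∈ F, c k * restriction (f k) ξ := by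
  have hcont : Continuous fun x : Space d => phase (-inner ℝ x (ξ : Space d)) :=
    continuous_phase.comp (by fun_prop)
  have hI : ∀ k ∈ F, Integrable fun x => phase (-inner ℝ x (ξ : Space d)) * f k x := fun k hk =>
    (hf k hk).bdd_mul hcont.aestronglyMeasurable (ae_of_all _ fun x => (norm_phase _).le)
  simp only [restriction_eq]
  simp_rw [← integral_const_mul]
  rw [← integral_finsetSum _ fun k hk => (hI k hk).const_mul _]
  refine integral_congr_ae (ae_of_all _ fun x => ?_)
  simp only [Finset.mul_sum]
  exact Finset.sum_congr rfl fun k _ => by ring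

variable [NeZero d]

/-- The Fourier transform of the part of `|E g|` in a lattice cube of the tube is large at every
point of the sphere. -/
lemma norm_restriction_cube_ge {h R : ℝ} (hh : 0 < h) (hdh : d * h ≤ 1 / 24) (hR : 0 < R)
    {k : Fin d → ℤ} (hk : latticeCube h k ⊆ tube d R) {b : ℝ} (hb : 0 ≤ b) (ξ : USphere d) :
    b * ((surfaceMeasure d).real (cap d (1 / 16 / Real.sqrt R)) / 2) * h ^ d ≤
      ‖restriction ((latticeCube h k).indicator fun x =>
        (b : ℂ) * wave (cap d (1 / 16 / Real.sqrt R)) x) ξ‖ := by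
  set K := cap d (1 / 16 / Real.sqrt R)
  have hKm : MeasurableSet K := measurableSet_cap _
  set m := (surfaceMeasure d).real K
  set Q : Set (Space d) := latticeCube h k
  have hQm : MeasurableSet Q := measurableSet_latticeCube hh k
  have hQv : volume Q = ENNReal.ofReal (h ^ d) := volume_latticeCube hh k
  have hQfin : volume Q ≠ ∞ := by rw [hQv]; exact ENNReal.ofReal_ne_top
  -- With `p` the lattice point, this unimodular factor turns the total phase into `(x - p)·(e₁ - ξ)
  -- + x·(η - e₁)`, and both terms are small.
  set t := -inner ℝ (latticePoint h k) (pole d - (ξ : Space d))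
  set f : Space d → ℂ := fun x =>
    phase t * (phase (-inner ℝ x (ξ : Space d)) * ((b : ℂ) * wave K x)) with hf
  have hfc : Continuous f := by
    have hc : Continuous fun x : Space d => phase (-inner ℝ x (ξ : Space d)) :=
      continuous_phase.comp (by fun_prop)
    have := continuous_wave K
    simp only [hf]
    fun_prop
  have hfi : IntegrableOn f Q := by
    refine Measure.integrableOn_of_bounded (M := b * m) hQfin hfc.aestronglyMeasurable
      (ae_of_all _ fun x => ?_)
    simp only [hf, norm_mul, norm_phase, one_mul, Complex.norm_real, Real.norm_of_nonneg hb]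
    exact mul_le_mul_of_nonneg_left (norm_wave_le K x) hb
  have heq : phase t * restriction (Q.indicator fun x => (b : ℂ) * wave K x) ξ = ∫ x in Q, f x := by
    rw [restriction_eq, ← integral_const_mul, ← integral_indicator hQm]
    refine integral_congr_ae (ae_of_all _ fun x => ?_)
    by_cases hx : x ∈ Q <;> simp [hx, hf]
  have hpt : ∀ x ∈ Q, b * (m / 2) ≤ (f x).re := fun x hx => by
    have hfx : f x = (b : ℂ) * ∫ η in K, phase (inner ℝ (x - latticePoint h k)
        (pole d - (ξ : Space d)) + inner ℝ x ((η : Space d) - pole d)) ∂surfaceMeasure d := by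
      simp only [hf, wave]
      have hcomm : ∀ z₁ z₂ z₃ z₄ : ℂ, z₁ * (z₂ * (z₃ * z₄)) = z₃ * (z₁ * (z₂ * z₄)) := by
        intros; ring
      rw [hcomm, ← integral_const_mul, ← integral_const_mul]
      congr 1
      refine integral_congr_ae (ae_of_all _ fun η => ?_)
      simp only
      rw [← phase_add, ← phase_add]
      congr 1
      simp only [t, inner_sub_left, inner_sub_right]
      ring
    have hint : Integrable (fun η : USphere d => phase (inner ℝ (x - latticePoint h k)
        (pole d - (ξ : Space d)) + inner ℝ x ((η : Space d) - pole d)))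
        ((surfaceMeasure d).restrict K) := integrable_phase_comp (by fun_prop) K
    rw [hfx, Complex.re_ofReal_mul]
    refine mul_le_mul_of_nonneg_left ?_ hb
    have hre := integral_re hint
    simp only [RCLike.re_to_complex] at hre
    rw [← hre]
    -- The bound `‖e₁ - ξ‖ ≤ 2` makes this uniform over the whole sphere, and dictates `d * h ≤ 1 /
    -- 24`.
    have h1 : |inner ℝ (x - latticePoint h k) (pole d - (ξ : Space d))| ≤ 1 / 12 := by
      have hx' := norm_sub_latticePoint_le hh hx
      have hs : ‖pole d - (ξ : Space d)‖ ≤ 2 := by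
        refine (norm_sub_le _ _).trans ?_
        rw [norm_pole, norm_eq_of_mem_sphere]; norm_num
      calc _ ≤ ‖x - latticePoint h k‖ * ‖pole d - (ξ : Space d)‖ := abs_real_inner_le_norm _ _
        _ ≤ (1 / 24) * 2 := mul_le_mul (hx'.trans hdh) hs (norm_nonneg _) (by norm_num)
        _ = _ := by norm_num
    have hmono := setIntegral_mono_on (μ := surfaceMeasure d) (s := K)
      (f := fun _ => (1 / 2 : ℝ)) (integrable_const _) hint.re hKm fun η hη => by
        refine half_le_re_phase ((abs_add_le _ _).trans ?_)
        have := abs_inner_sub_pole_le hR (hk hx) hη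
        linarith
    refine le_trans (le_of_eq ?_) hmono
    simp [m]; ring
  have hre := integral_re hfi
  simp only [RCLike.re_to_complex] at hre
  calc b * (m / 2) * h ^ d = ∫ _ in Q, b * (m / 2) := by
        rw [setIntegral_const, measureReal_def, hQv, ENNReal.toReal_ofReal (by positivity),
          smul_eq_mul]; ring
    _ ≤ ∫ x in Q, (f x).re :=
        setIntegral_mono_on (integrableOn_const hQfin) hfi.re hQm hpt
    _ = (∫ x in Q, f x).re := hre
    _ ≤ ‖∫ x in Q, f x‖ := Complex.re_le_norm _
    _ = _ := by rw [← heq, norm_mul, norm_phase, one_mul]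

lemma support_tubePotential_subset (q : ℝ≥0∞) (R : ℝ) :
    Function.support (tubePotential d q R) ⊆ tube d R :=
  Set.support_indicator_subset

/-- Lower bound for the first moment in terms of the surface measure of the cap and the number of
lattice cubes in the tube. -/
lemma expectedNormPow_one_ge_of_card {Ω : Type*} [MeasurableSpace Ω] {P : Measure Ω}
    [IsProbabilityMeasure P] {ω : (Fin d → ℤ) → Ω → ℝ} (hω : IsRandomCoefficients P ω)
    (q : ℝ≥0∞) {h R : ℝ} (hh : 0 < h) (hdh : d * h ≤ 1 / 24) (hR : 1 < R)
    {G : Finset (Fin d → ℤ)} (hG : ∀ k ∈ G, latticeCube h k ⊆ tube d R) :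
    ENNReal.ofReal (Real.sqrt ((surfaceMeasure d).real Set.univ * (G.card *
      (R ^ (-(((d : ℝ) + 1) / 2 * (q⁻¹).toReal)) *
        Real.sqrt ((surfaceMeasure d).real (cap d (1 / 16 / Real.sqrt R))) / 2 * h ^ d) ^ 2)) /
          (4 * fourthMoment)) ≤
      expectedNormPow P ω h (tubePotential d q R) 1 := by
  classical
  have hR0 : 0 < R := by linarith
  set σ := surfaceMeasure d
  set K := cap d (1 / 16 / Real.sqrt R)
  have hKm : MeasurableSet K := measurableSet_cap _
  set m := σ.real K
  have hm0 : 0 ≤ m := measureReal_nonneg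
  set τ := R ^ (-(((d : ℝ) + 1) / 2 * (q⁻¹).toReal))
  have hτ : 0 ≤ τ := Real.rpow_nonneg hR0.le _
  set V := tubePotential d q R
  set E : Space d → ℂ := fun x => (((Real.sqrt m)⁻¹ : ℝ) : ℂ) * wave K x with hE
  -- `F` captures every cube meeting the tube; lower bounds are known only on `G`. The other cubes
  -- can only increase the square sum.
  obtain ⟨F, hF, hGF⟩ : ∃ F : Finset (Fin d → ℤ),
      (∀ k ∉ F, Disjoint (latticeCube h k) (tube d R)) ∧ G ⊆ F := by
    obtain ⟨F, hF⟩ := exists_finset_disjoint_tube (d := d) hh hR.le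
    exact ⟨F ∪ G, fun k hk => hF k fun hkF => hk (Finset.mem_union_left _ hkF),
      Finset.subset_union_right⟩
  have hEc : Continuous E := continuous_const.mul (continuous_wave K)
  set f : (Fin d → ℤ) → Space d → ℂ := fun k x => (latticeCube h k).indicator V x * E x with hf
  have hfi : ∀ k, Integrable (f k) := fun k => by
    have hQ := measurableSet_latticeCube hh k
    have hT := measurableSet_tube (d := d) R
    have hfeq : f k = (latticeCube h k ∩ tube d R).indicator fun x => (τ : ℂ) * E x := by
      ext x
      by_cases h1 : x ∈ latticeCube h k <;> by_cases h2 : x ∈ tube d R <;>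
        simp [hf, V, tubePotential, h1, h2, τ]
    rw [hfeq, integrable_indicator_iff (hQ.inter hT)]
    have hfin : volume (latticeCube h k ∩ tube d R) ≠ ∞ := by
      refine ne_top_of_le_ne_top ?_ (measure_mono Set.inter_subset_left)
      rw [volume_latticeCube hh k]; exact ENNReal.ofReal_ne_top
    refine Measure.integrableOn_of_bounded (M := τ * ((Real.sqrt m)⁻¹ * m)) hfin
      (continuous_const.mul hEc).aestronglyMeasurable (ae_of_all _ fun x => ?_)
    simp only [hE, norm_mul, Complex.norm_real, Real.norm_of_nonneg hτ]
    rw [Real.norm_of_nonneg (by positivity : 0 ≤ (Real.sqrt m)⁻¹)]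
    gcongr
    exact norm_wave_le K x
  set a : (Fin d → ℤ) → USphere d → ℂ := fun k => restriction (f k)
  have ha : ∀ k, Continuous (a k) := fun k => continuous_restriction (hfi k)
  have hrestr : ∀ w, restriction (fun x => randomize h (fun k => ω k w) V x * E x) =
      fun ξ => ∑ k ∈ F, (ω k w : ℂ) * a k ξ := fun w => by
    ext ξ
    rw [← restriction_sum F (fun k => (ω k w : ℂ)) fun k _ => hfi k]
    congr 1
    ext x
    rw [randomize_eq_sum (F := F) fun k hk =>
      (hF k hk).mono_right (support_tubePotential_subset q R), Finset.sum_mul]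
    exact Finset.sum_congr rfl fun k _ => by simp only [hf]; ring
  set B := τ * Real.sqrt m / 2 * h ^ d
  have hB0 : 0 ≤ B := by positivity
  have hlow : ∀ k ∈ G, ∀ ξ, B ≤ ‖a k ξ‖ := fun k hk ξ => by
    have hfeq : f k = (latticeCube h k).indicator fun x =>
        ((τ * (Real.sqrt m)⁻¹ : ℝ) : ℂ) * wave K x := by
      ext x
      by_cases h1 : x ∈ latticeCube h k
      · simp [hf, hE, V, tubePotential, h1, hG k hk h1, τ]; ring
      · simp [hf, h1]
    have := norm_restriction_cube_ge hh hdh hR0 (hG k hk)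
      (b := τ * (Real.sqrt m)⁻¹) (by positivity) ξ
    refine le_trans (le_of_eq ?_) (this.trans (le_of_eq ?_))
    · have : (Real.sqrt m)⁻¹ * m = Real.sqrt m := by
        rw [inv_mul_eq_div, Real.div_sqrt]
      calc B = τ * ((Real.sqrt m)⁻¹ * m) / 2 * h ^ d := by rw [this]
        _ = _ := by ring
    · change _ = ‖restriction (f k) ξ‖
      rw [hfeq]
  have hsumF : ∀ ξ, (G.card : ℝ) * B ^ 2 ≤ ∑ k ∈ F, ‖a k ξ‖ ^ 2 := fun ξ => by
    calc (G.card : ℝ) * B ^ 2 = ∑ _k ∈ G, B ^ 2 := by simp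
      _ ≤ ∑ k ∈ G, ‖a k ξ‖ ^ 2 := Finset.sum_le_sum fun k hk => by gcongr; exact hlow k hk ξ
      _ ≤ _ := Finset.sum_le_sum_of_subset_of_nonneg hGF
          fun k _ _ => sq_nonneg _
  have hK4 := three_le_fourthMoment
  set s := σ.real Set.univ
  have hs : ENNReal.ofReal s = σ Set.univ := ofReal_measureReal
  -- Tonelli, then Khinchine at each fixed `ξ`.
  have hL1 : ENNReal.ofReal (Real.sqrt (G.card * B ^ 2) / (4 * fourthMoment)) * σ Set.univ ≤
      ∫⁻ w, ∫⁻ ξ, ‖∑ k ∈ F, (ω k w : ℂ) * a k ξ‖ₑ ∂σ ∂P := by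
    rw [lintegral_lintegral_swap]
    · rw [← lintegral_const]
      refine lintegral_mono fun ξ => ?_
      refine le_trans (ENNReal.ofReal_le_ofReal ?_) (khinchine_complex hω.indep
        (fun k => hω.isNormalized k) three_le_fourthMoment (fun k => a k ξ) F)
      gcongr
      exact hsumF ξ
    · have hmeas : AEMeasurable (fun p : Ω × USphere d => ∑ k ∈ F, (ω k p.1 : ℂ) * a k p.2)
          (P.prod σ) := by
        refine Finset.aemeasurable_fun_sum _ fun k _ => ?_
        have h1 : AEMeasurable (fun p : Ω × USphere d => ω k p.1) (P.prod σ) :=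
          (hω.isNormalized k).memLp.aestronglyMeasurable.aemeasurable.comp_quasiMeasurePreserving
            Measure.quasiMeasurePreserving_fst
        exact (Complex.measurable_ofReal.comp_aemeasurable h1).mul
          ((ha k).measurable.comp measurable_snd).aemeasurable
      exact hmeas.enorm
  -- For each `w`, Cauchy–Schwarz on the sphere passes from `L¹` to the `L²` norm in `sandwichNorm`,
  -- at the cost of `σ(M)^{1/2}`.
  have hupper : ∫⁻ w, ∫⁻ ξ, ‖∑ k ∈ F, (ω k w : ℂ) * a k ξ‖ₑ ∂σ ∂P ≤
      expectedNormPow P ω h V 1 * σ Set.univ ^ (1 / 2 : ℝ) := by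
    have hne : σ Set.univ ^ (1 / 2 : ℝ) ≠ ∞ :=
      ENNReal.rpow_ne_top_of_nonneg (by norm_num) (measure_ne_top _ _)
    rw [expectedNormPow, ← lintegral_mul_const' _ _ hne]
    refine lintegral_mono fun w => ?_
    have hc : Continuous fun ξ => ∑ k ∈ F, (ω k w : ℂ) * a k ξ :=
      continuous_finsetSum _ fun k _ => continuous_const.mul (ha k)
    have h1 := eLpNorm_le_eLpNorm_mul_rpow_measure_univ (μ := σ) (p := 1) (q := 2) (by norm_num)
      hc.aestronglyMeasurable
    rw [eLpNorm_one_eq_lintegral_enorm] at h1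
    refine h1.trans ?_
    have h2 := eLpNorm_restriction_le_sandwichNorm (randomize h (fun k => ω k w) V) hKm
    rw [show (restriction fun x => randomize h (fun k => ω k w) V x *
      ((((Real.sqrt ((surfaceMeasure d).real K))⁻¹ : ℝ) : ℂ) * wave K x)) = _ from hrestr w] at h2
    rw [pow_one]
    refine mul_le_mul' h2 (le_of_eq ?_)
    norm_num
  rcases (show 0 ≤ s from measureReal_nonneg).eq_or_lt with hs0 | hs0
  · rw [← hs0]; simp
  have hfinal := hL1.trans hupper
  rw [← hs, ENNReal.ofReal_rpow_of_pos hs0, ← Real.sqrt_eq_rpow] at hfinal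
  have hss : 0 < Real.sqrt s := Real.sqrt_pos.2 hs0
  have e : ENNReal.ofReal (Real.sqrt (G.card * B ^ 2) / (4 * fourthMoment)) * ENNReal.ofReal s =
      ENNReal.ofReal (Real.sqrt (s * (G.card * B ^ 2)) / (4 * fourthMoment)) *
        ENNReal.ofReal (Real.sqrt s) := by
    rw [← ENNReal.ofReal_mul (by positivity), ← ENNReal.ofReal_mul (by positivity),
      Real.sqrt_mul hs0.le]
    congr 1
    calc Real.sqrt (G.card * B ^ 2) / (4 * fourthMoment) * s
        = Real.sqrt (G.card * B ^ 2) / (4 * fourthMoment) * (Real.sqrt s * Real.sqrt s) := by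
          rw [Real.mul_self_sqrt hs0.le]
      _ = _ := by ring
  rw [e] at hfinal
  exact (ENNReal.mul_le_mul_iff_left (by simpa using hss) ENNReal.ofReal_ne_top).1 hfinal

end Knapp

/-! ### Moment bounds in powers of `R`, and necessity of `q ≤ d + 1` -/

section Consequences

variable {d : ℕ} [NeZero d]

/-- The constant in the lower bound for the first moment. -/
noncomputable def knappConstant (d : ℕ) : ℝ :=
  (surfaceMeasure d).real Set.univ * (1 / (64 * (d : ℝ) ^ 2)) ^ (d - 1) /
    (512 * fourthMoment ^ 2)

lemma cap_measure_ge {R : ℝ} (hR : 1 < R) :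
    1 / 4 * (1 / 16 / Real.sqrt R / (2 * d)) ^ (d - 1) ≤
      (surfaceMeasure d).real (cap d (1 / 16 / Real.sqrt R)) := by
  have hs : 1 ≤ Real.sqrt R := Real.one_le_sqrt.2 hR.le
  have h := surfaceMeasure_cap_ge (d := d) (r := 1 / 16 / Real.sqrt R) (by positivity)
    (by rw [div_le_one (by positivity)]; linarith)
  exact (ENNReal.ofReal_le_iff_le_toReal (measure_ne_top _ _)).1 h

lemma knappConstant_pos : 0 < knappConstant d := by
  have hd : (0 : ℝ) < d := by exact_mod_cast Nat.pos_of_ne_zero (NeZero.ne d)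
  have hK := three_le_fourthMoment
  have hs : 0 < (surfaceMeasure d).real Set.univ := by
    have h := cap_measure_ge (d := d) (R := 2) (by norm_num)
    refine lt_of_lt_of_le ?_ (h.trans (measureReal_mono (Set.subset_univ _)))
    positivity
  unfold knappConstant
  positivity

/-- Lower bound for the first moment of the norm of the randomized tube potential. -/
lemma expectedNormPow_one_ge {Ω : Type*} [MeasurableSpace Ω] {P : Measure Ω}
    [IsProbabilityMeasure P] {ω : (Fin d → ℤ) → Ω → ℝ} (hω : IsRandomCoefficients P ω)
    (q : ℝ≥0∞) {h R : ℝ} (hh : 0 < h) (hdh : d * h ≤ 1 / 24) (hR : 1 < R) :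
    ENNReal.ofReal (Real.sqrt (knappConstant d * h ^ d *
      R ^ (1 - ((d : ℝ) + 1) * (q⁻¹).toReal))) ≤
      expectedNormPow P ω h (tubePotential d q R) 1 := by
  have hd : 0 < d := Nat.pos_of_ne_zero (NeZero.ne d)
  have hd0 : (0 : ℝ) < d := by exact_mod_cast hd
  have hR0 : 0 < R := by linarith
  have hK := three_le_fourthMoment
  obtain ⟨G, hG, hcard⟩ := exists_finset_subset_tube (d := d) hh (by linarith) hR.le
  refine le_trans (ENNReal.ofReal_le_ofReal ?_) (expectedNormPow_one_ge_of_card hω q hh hdh hR hG)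
  have hm := cap_measure_ge (d := d) hR
  set s := (surfaceMeasure d).real Set.univ with hs
  set m := (surfaceMeasure d).real (cap d (1 / 16 / Real.sqrt R))
  set θ := (q⁻¹).toReal
  set τ := R ^ (-(((d : ℝ) + 1) / 2 * θ)) with hτ
  have hs0 : 0 ≤ s := measureReal_nonneg
  have hm0 : 0 ≤ m := measureReal_nonneg
  have hτ2 : R ^ (1 - ((d : ℝ) + 1) * θ) = R * τ ^ 2 := by
    rw [hτ, ← Real.rpow_natCast, ← Real.rpow_mul hR0.le]
    nth_rewrite 2 [← Real.rpow_one R]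
    rw [← Real.rpow_add hR0]
    congr 1
    push_cast; ring
  have hsq : 0 < Real.sqrt R := Real.sqrt_pos.2 hR0
  -- The transverse factors `R^{-(d-1)/2}` of the cap and `R^{(d-1)/2}` of the cube count cancel;
  -- only the length `R` survives.
  have hprod : R / 8 * (1 / (64 * (d : ℝ) ^ 2)) ^ (d - 1) ≤ m * (G.card * h ^ d) := by
    refine le_trans (le_of_eq ?_) (mul_le_mul hm hcard (by positivity) hm0)
    have e : (1 / (64 * (d : ℝ) ^ 2)) =
        (1 / 16 / Real.sqrt R / (2 * d)) * (Real.sqrt R / (2 * d)) := by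
      field_simp; norm_num
    rw [e, mul_pow]; ring
  rw [le_div_iff₀ (by positivity)]
  refine Real.le_sqrt_of_sq_le ?_
  rw [mul_pow, Real.sq_sqrt (by have := (knappConstant_pos (d := d)).le; positivity), hτ2]
  have e1 : knappConstant d * h ^ d * (R * τ ^ 2) * (4 * fourthMoment) ^ 2 =
      s * (τ ^ 2 * h ^ d / 4) * (R / 8 * (1 / (64 * (d : ℝ) ^ 2)) ^ (d - 1)) := by
    rw [knappConstant, ← hs]
    field_simp; ring
  have e2 : s * (G.card * (τ * Real.sqrt m / 2 * h ^ d) ^ 2) =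
      s * (τ ^ 2 * h ^ d / 4) * (m * (G.card * h ^ d)) := by
    rw [mul_pow, div_pow, mul_pow, Real.sq_sqrt hm0]; ring
  rw [e1, e2]
  exact mul_le_mul_of_nonneg_left hprod (by positivity)

omit [NeZero d] in
/-- The square of a lower bound for the first moment bounds the second moment from below. -/
lemma expectedNormPow_two_ge {Ω : Type*} [MeasurableSpace Ω] {P : Measure Ω}
    [IsProbabilityMeasure P] {ω : (Fin d → ℤ) → Ω → ℝ} {h : ℝ} {V : Space d → ℂ} {t : ℝ≥0∞}
    (ht : t ≠ ∞) (h1 : t ≤ expectedNormPow P ω h V 1) : t ^ 2 ≤ expectedNormPow P ω h V 2 := by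
  unfold expectedNormPow at *
  set X := fun w => sandwichNorm (randomize h (fun k => ω k w) V)
  -- This pointwise inequality replaces Jensen: integrating it needs no measurability of the
  -- operator norm in `w`.
  have hpt : ∀ x : ℝ≥0∞, 2 * t * x ^ 1 ≤ x ^ 2 + t ^ 2 := fun x => by
    by_cases hx : x = ∞
    · simp [hx]
    · lift x to NNReal using hx
      lift t to NNReal using ht
      norm_cast
      rw [pow_one, ← NNReal.coe_le_coe]
      push_cast
      nlinarith [sq_nonneg ((x : ℝ) - t)]
  have hint : 2 * t * t ≤ ∫⁻ w, X w ^ 2 ∂P + t ^ 2 := by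
    calc 2 * t * t ≤ 2 * t * ∫⁻ w, X w ^ 1 ∂P := by gcongr
      _ = ∫⁻ w, 2 * t * X w ^ 1 ∂P :=
          (lintegral_const_mul' _ _ (ENNReal.mul_ne_top (by norm_num) ht)).symm
      _ ≤ ∫⁻ w, (X w ^ 2 + t ^ 2) ∂P := lintegral_mono fun w => hpt _
      _ = _ := by rw [lintegral_add_right _ measurable_const]; simp
  have e : 2 * t * t = t ^ 2 + t ^ 2 := by ring
  rw [e] at hint
  exact (ENNReal.add_le_add_iff_right (ENNReal.pow_ne_top ht)).1 hint

lemma memLp_tubePotential (q : ℝ≥0∞) {R : ℝ} (hR : 1 ≤ R) :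
    MemLp (tubePotential d q R) q volume :=
  memLp_indicator_const q (measurableSet_tube R) _
    (Or.inr (ne_top_of_le_ne_top ENNReal.ofReal_ne_top (volume_tube_le hR)))

/-- The amplitude is chosen to cancel `|T_R|^{1/q}`, so the bound is uniform in `R`, and in `q`
because `1/q ≤ 1`. -/
lemma eLpNorm_tubePotential_le {q : ℝ≥0∞} (hq : 1 ≤ q) {R : ℝ} (hR : 1 ≤ R) :
    eLpNorm (tubePotential d q R) q volume ≤ ENNReal.ofReal (2 ^ d) := by
  have hR0 : 0 < R := by linarith
  -- At `q = ∞` both sides are `0`, as the convention `1/q = 0` requires.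
  have hθ : 1 / q.toReal = (q⁻¹).toReal := by rw [ENNReal.toReal_inv, one_div]
  set θ := (q⁻¹).toReal with hθd
  have hθ0 : 0 ≤ θ := ENNReal.toReal_nonneg
  have hθ1 : θ ≤ 1 := by
    rw [hθd]
    exact ENNReal.toReal_le_of_le_ofReal zero_le_one (by simpa using hq)
  have h := eLpNorm_indicator_const_le (μ := (volume : Measure (Space d))) (s := tube d R)
    (c := ((R ^ (-(((d : ℝ) + 1) / 2 * θ)) : ℝ) : ℂ)) q
  refine h.trans ?_
  rw [hθ, ← ofReal_norm, Complex.norm_real, Real.norm_of_nonneg (by positivity)]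
  calc _ ≤ ENNReal.ofReal (R ^ (-(((d : ℝ) + 1) / 2 * θ))) *
        ENNReal.ofReal (2 ^ d * R ^ (((d : ℝ) + 1) / 2)) ^ θ := by
        gcongr; exact volume_tube_le hR
    _ = ENNReal.ofReal ((2 ^ d) ^ θ) := by
        rw [ENNReal.ofReal_rpow_of_nonneg (by positivity) hθ0,
          ← ENNReal.ofReal_mul (by positivity), Real.mul_rpow (by positivity) (by positivity),
          ← Real.rpow_mul hR0.le, mul_left_comm, ← Real.rpow_add hR0]
        simp
    _ ≤ _ := by
        refine ENNReal.ofReal_le_ofReal ?_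
        calc ((2 : ℝ) ^ d) ^ θ ≤ ((2 : ℝ) ^ d) ^ (1 : ℝ) :=
              Real.rpow_le_rpow_of_exponent_le (one_le_pow₀ (by norm_num)) hθ1
          _ = _ := Real.rpow_one _

/-- No power of `x` with positive exponent is bounded by a power of `log x`. -/
lemma exists_log_rpow_lt_rpow {α b C N : ℝ} (hα : 0 < α) (hb : 0 < b) :
    ∃ x : ℝ, 4 < x ∧ C * Real.log x ^ N < b * (x / 4) ^ α := by
  have h := (isLittleO_log_rpow_rpow_atTop N hα).def
    (c := b * (1 / 4) ^ α / (2 * (|C| + 1))) (by positivity)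
  obtain ⟨x, hx, hx4⟩ := (h.and (Filter.eventually_gt_atTop (4 : ℝ))).exists
  refine ⟨x, hx4, ?_⟩
  have hx0 : 0 < x := by linarith
  have hlog : 0 ≤ Real.log x := Real.log_nonneg (by linarith)
  rw [Real.norm_of_nonneg (by positivity), Real.norm_of_nonneg (by positivity)] at hx
  have hxa : 0 < x ^ α := by positivity
  calc C * Real.log x ^ N ≤ (|C| + 1) * Real.log x ^ N := by
        gcongr
        linarith [le_abs_self C]
    _ ≤ (|C| + 1) * (b * (1 / 4) ^ α / (2 * (|C| + 1)) * x ^ α) := by gcongr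
    _ = b * (1 / 4) ^ α * x ^ α / 2 := by field_simp
    _ < b * (1 / 4) ^ α * x ^ α := half_lt_self (by positivity)
    _ = _ := by rw [mul_assoc, ← Real.mul_rpow (by norm_num) hx0.le]; congr 2; ring

/-- If `q > d + 1`, then `α = 1 - (d+1)/q > 0`, and the tube potentials, bounded in `L^q`, have
first moment at least a multiple of `R^{α/2}`, which beats every power of the logarithm. -/
lemma le_of_logExtensionBound {Ω : Type*} [MeasurableSpace Ω] {P : Measure Ω}
    [IsProbabilityMeasure P] {ω : (Fin d → ℤ) → Ω → ℝ} (hω : IsRandomCoefficients P ω)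
    {q : ℝ≥0∞} (hq : 1 ≤ q) {h C N : ℝ} (hh : 0 < h) (hdh : d * h ≤ 1 / 24)
    (hB : LogExtensionBound P ω q h C N) : q ≤ (d : ℝ≥0∞) + 1 := by
  by_contra! hcon
  set θ := (q⁻¹).toReal with hθ
  have hc := knappConstant_pos (d := d)
  have hα : 0 < 1 - ((d : ℝ) + 1) * θ := by
    have h1 : q⁻¹ < ((d : ℝ≥0∞) + 1)⁻¹ := ENNReal.inv_lt_inv.2 hcon
    have h2 : θ < ((d : ℝ) + 1)⁻¹ := by
      have := (ENNReal.toReal_lt_toReal h1.ne_top (by simp)).2 h1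
      rwa [ENNReal.toReal_inv (_ + _), ENNReal.toReal_add (by simp) (by simp),
        ENNReal.toReal_natCast, ENNReal.toReal_one] at this
    have h3 : (0 : ℝ) < (d : ℝ) + 1 := by positivity
    have := mul_lt_mul_of_pos_left h2 h3
    rw [mul_inv_cancel₀ h3.ne'] at this
    linarith
  set α := 1 - ((d : ℝ) + 1) * θ
  obtain ⟨x, hx, hlt⟩ := exists_log_rpow_lt_rpow (C := C * 2 ^ d) (N := N) (half_pos hα)
    (Real.sqrt_pos.2 (by positivity : 0 < knappConstant d * h ^ d))
  -- The tube lies in the ball of radius `2R`, so `R` is chosen to make `⟨2R⟩ = x`. The condition `4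
  -- < x` yields both `R > 1` and `R > x / 4`.
  set R := (x - 2) / 2 with hR
  have hR1 : 1 < R := by rw [hR]; linarith
  have hlow := expectedNormPow_one_ge hω q hh hdh hR1
  have hup := hB (2 * R) (by linarith) 0 (tubePotential d q R) (memLp_tubePotential q hR1.le)
    ((support_tubePotential_subset q R).trans (tube_subset_closedBall hR1.le))
  have hbr : bracket (2 * R) = x := by
    rw [bracket, abs_of_pos (by linarith), hR]; ring
  rw [hbr] at hup
  have hle := hlow.trans (hup.trans (mul_le_mul_right (eLpNorm_tubePotential_le hq hR1.le) _))
  rw [← ENNReal.ofReal_mul' (by positivity)] at hle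
  have hpos : 0 < Real.sqrt (knappConstant d * h ^ d * R ^ α) :=
    Real.sqrt_pos.2 (by have : 0 < R := by linarith
                        positivity)
  have hle' := (ENNReal.ofReal_le_ofReal_iff' .. ).1 hle
  have hle2 : Real.sqrt (knappConstant d * h ^ d * R ^ α) ≤ C * Real.log x ^ N * 2 ^ d :=
    hle'.resolve_right (by linarith)
  have hxR : (x / 4) ^ (α / 2) ≤ R ^ (α / 2) :=
    Real.rpow_le_rpow (by linarith) (by rw [hR]; linarith) (by linarith)
  rw [Real.sqrt_mul (by positivity), Real.sqrt_eq_rpow (R ^ α),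
    ← Real.rpow_mul (by linarith), mul_one_div] at hle2
  have : Real.sqrt (knappConstant d * h ^ d) * (x / 4) ^ (α / 2) ≤
      Real.sqrt (knappConstant d * h ^ d) * R ^ (α / 2) := by gcongr
  linarith

omit [NeZero d] in
lemma one_le_log_bracket {R : ℝ} (hR : 1 < R) : 1 ≤ Real.log (bracket R) := by
  have h3 : 3 ≤ bracket R := by
    rw [bracket, abs_of_pos (by linarith)]; linarith
  rw [Real.le_log_iff_exp_le (by linarith)]
  linarith [Real.exp_one_lt_d9]

-- At fixed `h`, `log⟨R⟩ ≥ 1` gives `log⟨h⟩ + log⟨R⟩ ≤ (log⟨h⟩ + 1) log⟨R⟩`; the exponent is then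
-- `1/2 + 2 = 5/2`.
omit [NeZero d] in
lemma LocalExtensionBound.logExtensionBound {Ω : Type*} [MeasurableSpace Ω] {P : Measure Ω}
    {ω : (Fin d → ℤ) → Ω → ℝ} {q : ℝ≥0∞} (hB : LocalExtensionBound P ω q) {h : ℝ} (hh : 0 < h) :
    ∃ C, LogExtensionBound P ω q h C (5 / 2) := by
  obtain ⟨C, hC⟩ := hB
  have hb2 : 2 ≤ bracket h := by unfold bracket; linarith [abs_nonneg h]
  have hlb : 0 ≤ Real.log (bracket h) := Real.log_nonneg (by linarith)
  refine ⟨|C| * bracket h ^ ((d : ℝ) / 2) * (Real.log (bracket h) + 1) ^ 2,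
    fun R hR x₀ V hV hsupp => ?_⟩
  refine (hC h R hh (by linarith) x₀ V hV hsupp).trans ?_
  refine mul_le_mul_left (ENNReal.ofReal_le_ofReal ?_) _
  have hL := one_le_log_bracket hR
  set L := Real.log (bracket R)
  set l := Real.log (bracket h)
  have e : L ^ (5 / 2 : ℝ) = L ^ (1 / 2 : ℝ) * L ^ 2 := by
    rw [← Real.rpow_natCast L 2, ← Real.rpow_add (by linarith)]; norm_num
  have hb : 0 ≤ bracket h ^ ((d : ℝ) / 2) := Real.rpow_nonneg (by linarith) _
  calc C * bracket h ^ ((d : ℝ) / 2) * L ^ (1 / 2 : ℝ) * (l + L) ^ 2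
      ≤ |C| * bracket h ^ ((d : ℝ) / 2) * L ^ (1 / 2 : ℝ) * ((l + 1) * L) ^ 2 := by
        gcongr
        · exact le_abs_self C
        · nlinarith
    _ = _ := by rw [e]; ring

end Consequences

end KnappExample

theorem mainTheorem8 (d : ℕ) [NeZero d] :
    ∃ h₀ c : ℝ, 0 < h₀ ∧ 0 < c ∧
      ∀ (Ω : Type*) [MeasurableSpace Ω] (P : Measure Ω) [IsProbabilityMeasure P]
        (ω : (Fin d → ℤ) → Ω → ℝ), KnappExample.IsRandomCoefficients P ω →
      ∀ q : ℝ≥0∞, 1 ≤ q →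
        (∀ h R : ℝ, 0 < h → h < h₀ → 1 < R →
          ENNReal.ofReal (c * h ^ d * R ^ (1 - ((d : ℝ) + 1) * (q⁻¹).toReal)) *
              eLpNorm (KnappExample.tubePotential d q R) q volume ≤
            KnappExample.expectedNormPow P ω h (KnappExample.tubePotential d q R) 2) ∧
        (KnappExample.LocalExtensionBound P ω q → q ≤ (d : ℝ≥0∞) + 1) ∧
        (∀ h C N : ℝ, 0 < h → h < h₀ →
          KnappExample.LogExtensionBound P ω q h C N → q ≤ (d : ℝ≥0∞) + 1) := by
  have hd : (0 : ℝ) < d := by exact_mod_cast Nat.pos_of_ne_zero (NeZero.ne d)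
  have hc := KnappExample.knappConstant_pos (d := d)
  have hdh : ∀ h : ℝ, h < 1 / (24 * d) → d * h ≤ 1 / 24 := fun h hh => by
    rw [lt_div_iff₀ (by positivity)] at hh
    linarith
  -- The threshold is the cube condition `d * h ≤ 1 / 24`; dividing by `2 ^ d` absorbs `‖V_R‖_q` in
  -- (i).
  refine ⟨1 / (24 * d), KnappExample.knappConstant d / 2 ^ d, by positivity, by positivity,
    fun Ω _ P _ ω hω q hq => ⟨fun h R hh hh₀ hR => ?_, fun hB => ?_, fun h C N hh hh₀ hB =>
      KnappExample.le_of_logExtensionBound hω hq hh (hdh h hh₀) hB⟩⟩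
  · have hR0 : 0 < R := by linarith
    have h1 := KnappExample.expectedNormPow_two_ge ENNReal.ofReal_ne_top
      (KnappExample.expectedNormPow_one_ge hω q hh (hdh h hh₀) hR)
    refine le_trans (mul_le_mul_right (KnappExample.eLpNorm_tubePotential_le hq hR.le) _) ?_
    refine le_trans (le_of_eq ?_) h1
    rw [← ENNReal.ofReal_mul (by positivity), ← ENNReal.ofReal_pow (by positivity),
      Real.sq_sqrt (by positivity)]
    congr 1
    field_simp
  · have hh : (0 : ℝ) < 1 / (24 * d) / 2 := by positivity
    obtain ⟨C, hC⟩ := hB.logExtensionBound hh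
    exact KnappExample.le_of_logExtensionBound hω hq hh (hdh _ (half_lt_self (by positivity))) hC
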